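/- Let $E\to M$ be a smooth real vector bundle of finite rank over a smooth manifold. Let $(\mathfrak{D}E,[\cdot,\cdot]_{\mathfrak D},\mathbb{j})$ be its gauge Lie algebroid: sections are the $\mathbb R$-linear operators $\mathfrak d$ on $\Gamma(E)$ with a symbol $\mathbb{j}(\mathfrak d)\in\mathfrak X(M)$ such that $\mathfrak d(fu)=f\,\mathfrak d(u)+\mathbb{j}(\mathfrak d)(f)\,u$, with the commutator bracket; bundle endomorphisms of $E$ are those with zero symbol. Let $\mathfrak{J}E=\{\nu\in\mathrm{Hom}(\mathfrak{D}E,E) : \nu(\Phi)=\Phi(\nu(\mathrm{id}_E))\ \ \forall\,\Phi\in\mathrm{gl}(E)\}$ be the first jet bundle of $E$, with $\langle\mu,\mathfrak d\rangle=\mu(\mathfrak d)$. For $u\in\Gamma(E)$ put $\mathbb{d}u(\mathfrak d)=\mathfrak d(u)$, and for $\mathfrak d\in\Gamma(\mathfrak DE)$, $\mu\in\Gamma(\mathfrak JE)$ put $(\mathfrak L_{\mathfrak d}\mu)(\mathfrak t)=\mathfrak d(\mu(\mathfrak t))-\mu([\mathfrak d,\mathfrak t]_{\mathfrak D})$. The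 omni-Lie algebroid of $E$ is $\mathfrak{ol}(E)=\mathfrak{D}E\oplus\mathfrak{J}E$ with the $E$-valued pairing $(\mathfrak d+\mu,\mathfrak t+\nu)_E=\frac12(\mu(\mathfrak t)+\nu(\mathfrak d))$ and the bracket $[\![\mathfrak d+\mu,\mathfrak r+\nu]\!]=[\mathfrak d,\mathfrak r]_{\mathfrak D}+\mathfrak L_{\mathfrak d}\nu-\mathfrak L_{\mathfrak r}\mu+\mathbb{d}(\mu(\mathfrak r))$ on sections. A generalized complex structure on $\mathfrak{ol}(E)$ is a bundle map $\mathcal J:\mathfrak{ol}(E)\to\mathfrak{ol}(E)$ with $\mathcal J^2=-\mathrm{id}$, $(\mathcal Jx,\mathcal Jy)_E=(x,y)_E$ and $[\![\mathcal Jx,\mathcal Jy]\!]-[\![x,y]\!]-\mathcal J([\![\mathcal Jx,y]\!]+[\![x,\mathcal Jy]\!])=0$ for all sections $x,y$. Let $(E,[\cdot,\cdot]_E,a)$ be a Lie algebroid and let $\pi^\sharp:\mathfrak{J}E\to\mathfrak{D}E$ be the bundle map with $\pi^\sharp(\mathbb{d}u)=[u,\cdot]_E$ for all $u\in\Gamma(E)$.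 Let $N:\mathfrak{D}E\to\mathfrak{D}E$ be a Nijenhuis operator, i.e. a bundle map with $[N\mathfrak d,N\mathfrak t]_{\mathfrak D}=N\big([N\mathfrak d,\mathfrak t]_{\mathfrak D}+[\mathfrak d,N\mathfrak t]_{\mathfrak D}-N[\mathfrak d,\mathfrak t]_{\mathfrak D}\big)$ for all sections $\mathfrak d,\mathfrak t$, and let $N^\star\nu=\nu\circ N$. For a bundle map $P:\mathfrak{J}E\to\mathfrak{D}E$ put $[\mu,\nu]_{P}=\mathfrak L_{P\mu}\nu-\mathfrak L_{P\nu}\mu-\mathbb{d}(\nu(P\mu))$. The pair $(\pi,N)$ is an algebroid-Nijenhuis structure if $N$ is Nijenhuis, $N^\star(\mathfrak{J}E)\subseteq\mathfrak{J}E$, $N\circ\pi^\sharp=\pi^\sharp\circ N^\star$ on $\mathfrak{J}E$, and $$[\mu,\nu]_{N\circ\pi^\sharp}=[N^\star\mu,\nu]_{\pi^\sharp}+[\mu,N^\star\nu]_{\pi^\sharp}-N^\star[\mu,\nu]_{\pi^\sharp}\qquad\text{for all }\mu,\nu\in\Gamma(\mathfrak{J}E).$$ Theorem. The following are equivalent: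 (a) $(\pi,N)$ is an algebroid-Nijenhuis structure and $N^2=-\mathrm{id}$; (b) $N^\star(\mathfrak JE)\subseteq\mathfrak JE$, and the bundle map $\mathcal J=\begin{pmatrix}N&\pi^\sharp\\0&-N^\star\end{pmatrix}$, that is, $\mathcal J(\mathfrak d+\mu)=N\mathfrak d+\pi^\sharp\mu-N^\star\mu$, is a generalized complex structure on $\mathfrak{ol}(E)$. -/

import Mathlib

open scoped Manifold ContDiff Bundle

noncomputable section

namespace OmniLie

/-! ## Smooth sections of a vector bundle as a module over the smooth functions -/

section Sections

variable {EM : Type*} [NormedAddCommGroup EM] [NormedSpace ℝ EM]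
  {H : Type*} [TopologicalSpace H] {I : ModelWithCorners ℝ EM H}
  {M : Type*} [TopologicalSpace M] [ChartedSpace H M]
  {F : Type*} [NormedAddCommGroup F] [NormedSpace ℝ F]
  {V : M → Type*} [TopologicalSpace (Bundle.TotalSpace F V)]
  [∀ x, AddCommGroup (V x)] [∀ x, Module ℝ (V x)]
  [∀ x, TopologicalSpace (V x)] [FiberBundle F V] [VectorBundle ℝ F V]

/-- Pointwise multiplication of a smooth section by a smooth function. -/
instance instSMulSection : SMul C^∞⟮I, M; ℝ⟯ Cₛ^∞⟮I; F, V⟯ where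
  smul f s := ⟨fun x => f x • s x, f.contMDiff.smul_section s.contMDiff⟩

theorem smul_section_apply (f : C^∞⟮I, M; ℝ⟯) (s : Cₛ^∞⟮I; F, V⟯) (x : M) :
    (f • s) x = f x • s x := rfl

/-- `Γ(V)` is a module over `C^∞(M)`. -/
instance instModuleSection : Module C^∞⟮I, M; ℝ⟯ Cₛ^∞⟮I; F, V⟯ where
  one_smul s := by ext x; exact one_smul ℝ (s x)
  mul_smul f g s := by ext x; exact mul_smul (f x) (g x) (s x)
  smul_zero f := by ext x; exact smul_zero (f x)
  smul_add f s t := by ext x; exact smul_add (f x) (s x) (t x)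
  add_smul f g s := by ext x; exact add_smul (f x) (g x) (s x)
  zero_smul s := by ext x; exact zero_smul ℝ (s x)

instance instTowerSection : IsScalarTower ℝ C^∞⟮I, M; ℝ⟯ Cₛ^∞⟮I; F, V⟯ where
  smul_assoc r f s := by ext x; exact smul_assoc r (f x) (s x)

end Sections

/-! ## Differential calculus on the section modules

In what follows `A` stands for `C^∞(M)` and `S` for `Γ(E)`. A vector field on `M` is a derivation of
`C^∞(M)`, and a morphism `P → Q` of vector bundles over `M` is a `C^∞(M)`-linear map
`Γ(P) → Γ(Q)`. -/

section Algebroid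

variable (A : Type*) [CommRing A] [Algebra ℝ A]

/-- A Lie algebroid structure on a vector bundle with module of sections `L`: a Lie bracket on the
sections and a bundle map (the anchor) to the tangent bundle, related by the Leibniz rule. -/
structure LieAlgebroid (L : Type*) [AddCommGroup L] [Module ℝ L] [Module A L] where
  /-- the Lie bracket on sections -/
  bracket : L →ₗ[ℝ] L →ₗ[ℝ] L
  /-- the anchor -/
  anchor : L →ₗ[A] Derivation ℝ A A
  bracket_self : ∀ u, bracket u u = 0
  jacobi : ∀ u v w, bracket u (bracket v w) = bracket (bracket u v) w + bracket v (bracket u w)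
  leibniz : ∀ (u : L) (f : A) (v : L), bracket u (f • v) = f • bracket u v + anchor u f • v

variable {A}

theorem LieAlgebroid.bracket_skew {L : Type*} [AddCommGroup L] [Module ℝ L] [Module A L]
    (𝓛 : LieAlgebroid A L) (u v : L) : 𝓛.bracket u v = -𝓛.bracket v u := by
  have h := 𝓛.bracket_self (u + v)
  simp only [map_add, LinearMap.add_apply, 𝓛.bracket_self, zero_add, add_zero] at h
  exact eq_neg_of_add_eq_zero_right h

/-- The Nijenhuis torsion
`T(N)(d, t) = [N d, N t] - N ([N d, t] + [d, N t] - N [d, t])` of a bundle map `N`. -/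
def nijenhuisTorsion {L : Type*} [AddCommGroup L] [Module ℝ L] [Module A L]
    (𝓛 : LieAlgebroid A L) (N : L →ₗ[A] L) (d t : L) : L :=
  𝓛.bracket (N d) (N t) - N (𝓛.bracket (N d) t + 𝓛.bracket d (N t) - N (𝓛.bracket d t))

/-- A Nijenhuis operator on a Lie algebroid: a bundle map with vanishing torsion. -/
def IsNijenhuis {L : Type*} [AddCommGroup L] [Module ℝ L] [Module A L]
    (𝓛 : LieAlgebroid A L) (N : L →ₗ[A] L) : Prop :=
  ∀ d t, nijenhuisTorsion 𝓛 N d t = 0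

end Algebroid

section Gauge

variable (A : Type*) [CommRing A] [Algebra ℝ A]
  (S : Type*) [AddCommGroup S] [Module ℝ S] [Module A S] [IsScalarTower ℝ A S]

/-- `Γ(𝔇E)`, the sections of the gauge Lie algebroid of `E` (covariant differential operators):
pairs of an `ℝ`-linear operator `D` on `Γ(E)` and a vector field `X` (the symbol of `D`) with
`D (f u) = f D u + X(f) u`. -/
def Gauge : Submodule A ((S →ₗ[ℝ] S) × Derivation ℝ A A) where
  carrier := {d | ∀ (f : A) (u : S), d.1 (f • u) = f • d.1 u + d.2 f • u}
  add_mem' := by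
    intro d t hd ht f u
    simp only [Prod.fst_add, Prod.snd_add, LinearMap.add_apply, Derivation.add_apply, hd f u,
      ht f u, smul_add, add_smul]
    abel
  zero_mem' := by intro f u; simp
  smul_mem' := by
    intro g d hd f u
    simp only [Prod.smul_fst, Prod.smul_snd, LinearMap.smul_apply, Derivation.smul_apply, hd f u,
      smul_add, smul_smul, smul_eq_mul, mul_comm]

variable {A S}

namespace Gauge

/-- The action of a section of `𝔇E` on a section of `E`. -/
def act (d : Gauge A S) (u : S) : S := d.1.1 u

/-- The anchor `𝕛 : 𝔇E → TM`. -/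
def symbol : Gauge A S →ₗ[A] Derivation ℝ A A :=
  (LinearMap.snd A (S →ₗ[ℝ] S) (Derivation ℝ A A)).comp (Gauge A S).subtype

theorem ext {d t : Gauge A S} (h : ∀ u, act d u = act t u) (h' : symbol d = symbol t) : d = t :=
  Subtype.ext (Prod.ext (LinearMap.ext h) h')

theorem act_smul_right (d : Gauge A S) (f : A) (u : S) :
    act d (f • u) = f • act d u + symbol d f • u := d.2 f u

@[simp] theorem act_add_right (d : Gauge A S) (u v : S) : act d (u + v) = act d u + act d v :=
  map_add d.1.1 u v

@[simp] theorem act_sub_right (d : Gauge A S) (u v : S) : act d (u - v) = act d u - act d v :=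
  map_sub d.1.1 u v

@[simp] theorem act_rsmul_right (d : Gauge A S) (r : ℝ) (u : S) : act d (r • u) = r • act d u :=
  map_smul d.1.1 r u

@[simp] theorem act_zero_right (d : Gauge A S) : act d 0 = 0 := map_zero d.1.1

@[simp] theorem act_neg_right (d : Gauge A S) (u : S) : act d (-u) = -act d u := map_neg d.1.1 u

@[simp] theorem act_add (d t : Gauge A S) (u : S) : act (d + t) u = act d u + act t u := rfl

@[simp] theorem act_smul (f : A) (d : Gauge A S) (u : S) : act (f • d) u = f • act d u := rfl

@[simp] theorem act_rsmul (r : ℝ) (d : Gauge A S) (u : S) : act (r • d) u = r • act d u := rfl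

/-- The inclusion `𝕚 : gl(E) → 𝔇E` of the bundle endomorphisms. -/
def ofEnd : (S →ₗ[A] S) →ₗ[A] Gauge A S where
  toFun Φ := ⟨(Φ.restrictScalars ℝ, 0), by intro f u; simp⟩
  map_add' Φ Ψ := by apply ext <;> intros <;> simp [act, symbol]
  map_smul' f Φ := by apply ext <;> intros <;> simp [act, symbol]

@[simp] theorem act_ofEnd (Φ : S →ₗ[A] S) (u : S) : act (ofEnd Φ) u = Φ u := rfl

@[simp] theorem symbol_ofEnd (Φ : S →ₗ[A] S) : symbol (ofEnd Φ) = 0 := rfl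

/-- The commutator bracket on `Γ(𝔇E)`. -/
def comm (d t : Gauge A S) : Gauge A S :=
  ⟨(d.1.1 ∘ₗ t.1.1 - t.1.1 ∘ₗ d.1.1, ⁅symbol d, symbol t⁆), by
    intro f u
    change act d (act t (f • u)) - act t (act d (f • u)) =
      f • (act d (act t u) - act t (act d u)) + ⁅symbol d, symbol t⁆ f • u
    simp only [act_smul_right, act_add_right, Derivation.commutator_apply, smul_sub, sub_smul]
    abel⟩

@[simp] theorem act_comm (d t : Gauge A S) (u : S) :
    act (comm d t) u = act d (act t u) - act t (act d u) := rfl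

@[simp] theorem symbol_comm (d t : Gauge A S) : symbol (comm d t) = ⁅symbol d, symbol t⁆ := rfl

end Gauge

variable (A S) in
/-- The gauge Lie algebroid `(𝔇E, [·,·]_𝔇, 𝕛)`. -/
def gaugeLieAlgebroid : LieAlgebroid A (Gauge A S) where
  bracket := LinearMap.mk₂ ℝ Gauge.comm
    (by
      intro d d' t; apply Gauge.ext
      · intro u; simp; abel
      · simp)
    (by
      intro r d t; apply Gauge.ext
      · intro u; simp [smul_sub]
      · simp)
    (by
      intro d t t'; apply Gauge.ext
      · intro u; simp; abel
      · simp)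
    (by
      intro r d t; apply Gauge.ext
      · intro u; simp [smul_sub]
      · simp)
  anchor := Gauge.symbol
  bracket_self d := by
    apply Gauge.ext
    · intro u; simp [LinearMap.mk₂_apply]; rfl
    · simp [LinearMap.mk₂_apply]
  jacobi d t k := by
    apply Gauge.ext
    · intro u; simp [LinearMap.mk₂_apply]; abel
    · simp [LinearMap.mk₂_apply]
  leibniz d f t := by
    apply Gauge.ext
    · intro u
      simp [LinearMap.mk₂_apply, Gauge.act_smul_right, smul_sub]; abel
    · ext g
      simp [LinearMap.mk₂_apply, Derivation.commutator_apply]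

/-- The bracket `[d, t]_𝔇` on `Γ(𝔇E)`. -/
def gbr (d t : Gauge A S) : Gauge A S := (gaugeLieAlgebroid A S).bracket d t

@[simp] theorem act_gbr (d t : Gauge A S) (u : S) :
    Gauge.act (gbr d t) u = Gauge.act d (Gauge.act t u) - Gauge.act t (Gauge.act d u) := rfl

@[simp] theorem symbol_gbr (d t : Gauge A S) :
    Gauge.symbol (gbr d t) = ⁅Gauge.symbol d, Gauge.symbol t⁆ := rfl

variable (A S) in
/-- `Γ(𝔍E)`, the sections of the first jet bundle of `E`, realised as the `E`-dual bundle of `𝔇E`: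
bundle maps `ν : 𝔇E → E` with `ν(Φ) = Φ (ν(id))` for all `Φ ∈ gl(E)`. The `E`-valued pairing of
`𝔍E` and `𝔇E` is evaluation. -/
def Jet : Submodule A (Gauge A S →ₗ[A] S) where
  carrier := {ν | ∀ Φ : S →ₗ[A] S, ν (Gauge.ofEnd Φ) = Φ (ν (Gauge.ofEnd LinearMap.id))}
  add_mem' := by intro μ ν hμ hν Φ; simp [hμ Φ, hν Φ]
  zero_mem' := by intro Φ; simp
  smul_mem' := by intro f ν hν Φ; simp [hν Φ]

/-- The jet prolongation `𝕕 : Γ(E) → Γ(𝔍E)`, `𝕕u(d) = d(u)`. -/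
def jetd (u : S) : Jet A S :=
  ⟨{ toFun := fun d => Gauge.act d u
     map_add' := fun _ _ => rfl
     map_smul' := fun _ _ => rfl }, fun _ => rfl⟩

@[simp] theorem jetd_apply (u : S) (d : Gauge A S) : (jetd u : Jet A S).1 d = Gauge.act d u := rfl

/-- The Lie derivative on `Γ(𝔍E)`: `(𝔏_d μ)(t) = d (μ(t)) - μ([d, t]_𝔇)`. -/
def lieDer (d : Gauge A S) (μ : Jet A S) : Jet A S :=
  ⟨{ toFun := fun t => Gauge.act d (μ.1 t) - μ.1 (gbr d t)
     map_add' := by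
       intro t t'
       simp only [gbr, map_add, Gauge.act_add_right]
       abel
     map_smul' := by
       intro f t
       have h := (gaugeLieAlgebroid A S).leibniz d f t
       change gbr d (f • t) = f • gbr d t + Gauge.symbol d f • t at h
       simp only [h, map_smul, map_add, Gauge.act_smul_right, RingHom.id_apply, smul_sub]
       abel },
   by
    intro Φ
    have key : ∀ Ψ : S →ₗ[A] S, Gauge.act d (μ.1 (Gauge.ofEnd Ψ)) - μ.1 (gbr d (Gauge.ofEnd Ψ))
        = Ψ (Gauge.act d (μ.1 (Gauge.ofEnd LinearMap.id))) := by
      intro Ψ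
      let Ξ : S →ₗ[A] S :=
        { toFun := fun u => Gauge.act d (Ψ u) - Ψ (Gauge.act d u)
          map_add' := by intro u v; simp only [map_add, Gauge.act_add_right]; abel
          map_smul' := by
            intro f u
            simp only [map_smul, map_add, Gauge.act_smul_right, RingHom.id_apply, smul_sub]
            abel }
      have hΞ : gbr d (Gauge.ofEnd Ψ) = Gauge.ofEnd Ξ := by
        apply Gauge.ext
        · intro u; rfl
        · simp
      rw [hΞ, μ.2 Ξ, μ.2 Ψ]
      simp [Ξ]
    change Gauge.act d (μ.1 (Gauge.ofEnd Φ)) - μ.1 (gbr d (Gauge.ofEnd Φ)) =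
      Φ (Gauge.act d (μ.1 (Gauge.ofEnd LinearMap.id)) - μ.1 (gbr d (Gauge.ofEnd LinearMap.id)))
    rw [key Φ, key LinearMap.id, LinearMap.id_apply]⟩

@[simp] theorem lieDer_apply (d : Gauge A S) (μ : Jet A S) (t : Gauge A S) :
    (lieDer d μ).1 t = Gauge.act d (μ.1 t) - μ.1 (gbr d t) := rfl

/-! ## The omni-Lie algebroid `ol(E) = 𝔇E ⊕ 𝔍E` and its generalized complex structures -/

variable (A S) in
/-- The sections of `ol(E) = 𝔇E ⊕ 𝔍E`. -/
abbrev Omni : Type _ := Gauge A S × Jet A S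

/-- The `E`-valued pairing `(d + μ, t + ν)_E = ½ (μ(t) + ν(d))`. -/
def omniPairing (x y : Omni A S) : S := (1 / 2 : ℝ) • (x.2.1 y.1 + y.2.1 x.1)

/-- The Dorfman bracket `⟦d + μ, r + ν⟧ = [d, r]_𝔇 + 𝔏_d ν - 𝔏_r μ + 𝕕(μ(r))`. -/
def dorfman (x y : Omni A S) : Omni A S :=
  (gbr x.1 y.1, lieDer x.1 y.2 - lieDer y.1 x.2 + jetd (x.2.1 y.1))

/-- A generalized complex structure on the omni-Lie algebroid. -/
structure IsGeneralizedComplex (J : Omni A S →ₗ[A] Omni A S) : Prop where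
  sq : ∀ x, J (J x) = -x
  orthogonal : ∀ x y, omniPairing (J x) (J y) = omniPairing x y
  integrable : ∀ x y,
    dorfman (J x) (J y) - dorfman x y - J (dorfman (J x) y + dorfman x (J y)) = 0

/-! ## Algebroid-Nijenhuis structures -/

/-- The `E`-dual map `N^⋆ : Hom(𝔇E, E) → Hom(𝔇E, E)`, `N^⋆(ν) = ν ∘ N`. -/
def starMap (N : Gauge A S →ₗ[A] Gauge A S) :
    (Gauge A S →ₗ[A] S) →ₗ[A] (Gauge A S →ₗ[A] S) :=
  LinearMap.lcomp A S N

/-- The condition `N^⋆(𝔍E) ⊆ 𝔍E`. -/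
def PreservesJet (N : Gauge A S →ₗ[A] Gauge A S) : Prop :=
  ∀ ν ∈ Jet A S, starMap N ν ∈ Jet A S

/-- The restriction `N^⋆ : 𝔍E → 𝔍E`. -/
def jetStar (N : Gauge A S →ₗ[A] Gauge A S) (hN : PreservesJet N) : Jet A S →ₗ[A] Jet A S :=
  (starMap N).restrict hN

@[simp] theorem jetStar_apply (N : Gauge A S →ₗ[A] Gauge A S) (hN : PreservesJet N)
    (ν : Jet A S) (d : Gauge A S) : (jetStar N hN ν).1 d = ν.1 (N d) := rfl

/-- The bundle map `𝒥 = (N, π^♯; 0, -N^⋆)` of `ol(E)`: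
`𝒥(d + μ) = N d + π^♯ μ - N^⋆ μ`. -/
def omniMatrix (N : Gauge A S →ₗ[A] Gauge A S) (hN : PreservesJet N)
    (pi : Jet A S →ₗ[A] Gauge A S) : Omni A S →ₗ[A] Omni A S :=
  (N.coprod pi).prod (-(jetStar N hN ∘ₗ LinearMap.snd A (Gauge A S) (Jet A S)))

@[simp] theorem omniMatrix_apply (N : Gauge A S →ₗ[A] Gauge A S) (hN : PreservesJet N)
    (pi : Jet A S →ₗ[A] Gauge A S) (d : Gauge A S) (μ : Jet A S) :
    omniMatrix N hN pi (d, μ) = (N d + pi μ, -jetStar N hN μ) := rfl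

/-- For `π^♯ : 𝔍E → 𝔇E`, the bracket
`[μ, ν]_π = 𝔏_{π^♯ μ} ν - 𝔏_{π^♯ ν} μ - 𝕕 ⟨π^♯ μ, ν⟩_E` on `Γ(𝔍E)`. -/
def piBracket (pi : Jet A S →ₗ[A] Gauge A S) (μ ν : Jet A S) : Jet A S :=
  lieDer (pi μ) ν - lieDer (pi ν) μ - jetd (ν.1 (pi μ))

/-- `C(π, N)(μ, ν) = [μ, ν]_{π_N} - ([N^⋆ μ, ν]_π + [μ, N^⋆ ν]_π - N^⋆ [μ, ν]_π)`, where
`π_N(μ, ν) = ⟨ν, N π^♯ μ⟩_E`, that is, `π_N^♯ = N ∘ π^♯`. -/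
def concomitant (pi : Jet A S →ₗ[A] Gauge A S) (N : Gauge A S →ₗ[A] Gauge A S)
    (hN : PreservesJet N) (μ ν : Jet A S) : Jet A S :=
  piBracket (N ∘ₗ pi) μ ν -
    (piBracket pi (jetStar N hN μ) ν + piBracket pi μ (jetStar N hN ν) -
      jetStar N hN (piBracket pi μ ν))

/-- The covariant differential operator `[u, ·]_E` with symbol `a(u)`. -/
def ad (𝓔 : LieAlgebroid A S) (u : S) : Gauge A S :=
  ⟨(𝓔.bracket u, 𝓔.anchor u), fun f v => 𝓔.leibniz u f v⟩

/-- The bundle map `π^♯ : 𝔍E → 𝔇E` is the one induced by the Lie algebroid structure of `E`: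
`π^♯(𝕕u) = [u, ·]_E` for all `u ∈ Γ(E)`. -/
def IsInducedBy (𝓔 : LieAlgebroid A S) (pi : Jet A S →ₗ[A] Gauge A S) : Prop :=
  ∀ u : S, pi (jetd u) = ad 𝓔 u

/-- `(π, N)` is an algebroid-Nijenhuis structure on the Lie algebroid `E`. -/
structure IsAlgebroidNijenhuis (𝓔 : LieAlgebroid A S) (pi : Jet A S →ₗ[A] Gauge A S)
    (N : Gauge A S →ₗ[A] Gauge A S) : Prop where
  induced : IsInducedBy 𝓔 pi
  nijenhuis : IsNijenhuis (gaugeLieAlgebroid A S) N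
  preservesJet : PreservesJet N
  comm : N ∘ₗ pi = pi ∘ₗ jetStar N preservesJet
  concomitant_eq_zero : ∀ μ ν, concomitant pi N preservesJet μ ν = 0

/-- The induced bundle map exists: `π^♯(μ)(v) = -μ([v, ·]_E)`, with symbol `a(𝕡 μ)`, where
`𝕡 μ = μ(id) ∈ Γ(E)`. -/
theorem exists_isInducedBy (𝓔 : LieAlgebroid A S) :
    ∃ pi : Jet A S →ₗ[A] Gauge A S, IsInducedBy 𝓔 pi := by
  have hadd : ∀ u v, ad 𝓔 (u + v) = ad 𝓔 u + ad 𝓔 v := fun u v => by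
    apply Subtype.ext; simp [ad]
  have hsm : ∀ (r : ℝ) u, ad 𝓔 (r • u) = r • ad 𝓔 u := fun r u => by
    apply Gauge.ext
    · intro w; simp [ad, Gauge.act]
    · change 𝓔.anchor (r • u) = r • 𝓔.anchor u
      rw [← algebraMap_smul A r u, map_smul, algebraMap_smul]
  let an : A → S → (S →ₗ[A] S) := fun f v =>
    { toFun := fun w => 𝓔.anchor w f • v
      map_add' := by intro w w'; simp [add_smul]
      map_smul' := by intro g w; simp [mul_smul] }
  have hleib : ∀ (f : A) v, ad 𝓔 (f • v) = f • ad 𝓔 v - Gauge.ofEnd (an f v) := fun f v => by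
    apply Gauge.ext
    · intro w
      change 𝓔.bracket (f • v) w = f • 𝓔.bracket v w - 𝓔.anchor w f • v
      rw [𝓔.bracket_skew, 𝓔.leibniz, 𝓔.bracket_skew w v, smul_neg]
      abel
    · rw [map_sub, map_smul, Gauge.symbol_ofEnd, sub_zero]
      exact map_smul 𝓔.anchor f v
  refine ⟨{ toFun := fun μ => ⟨({ toFun := fun v => -μ.1 (ad 𝓔 v), map_add' := ?_, map_smul' := ?_ },
      𝓔.anchor (μ.1 (Gauge.ofEnd LinearMap.id))), ?_⟩, map_add' := ?_, map_smul' := ?_ }, ?_⟩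
  · intro u v; rw [hadd, map_add, neg_add]
  · intro r u
    rw [hsm, RingHom.id_apply, ← algebraMap_smul A r (ad 𝓔 u), map_smul, algebraMap_smul, smul_neg]
  · intro f u
    change -μ.1 (ad 𝓔 (f • u)) = f • (-μ.1 (ad 𝓔 u)) +
      𝓔.anchor (μ.1 (Gauge.ofEnd LinearMap.id)) f • u
    rw [hleib, map_sub, map_smul, μ.2 (an f u)]
    simp only [an, LinearMap.coe_mk, AddHom.coe_mk, smul_neg]
    abel
  · intro μ ν
    apply Gauge.ext
    · intro v
      change -(μ.1 (ad 𝓔 v) + ν.1 (ad 𝓔 v)) = -μ.1 (ad 𝓔 v) + -ν.1 (ad 𝓔 v)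
      abel
    · exact map_add 𝓔.anchor (μ.1 (Gauge.ofEnd LinearMap.id)) (ν.1 (Gauge.ofEnd LinearMap.id))
  · intro f μ
    apply Gauge.ext
    · intro v
      exact (smul_neg f (μ.1 (ad 𝓔 v))).symm
    · exact map_smul 𝓔.anchor f (μ.1 (Gauge.ofEnd LinearMap.id))
  · intro u
    apply Gauge.ext
    · intro v
      exact (𝓔.bracket_skew u v).symm
    · rfl

end Gauge

end OmniLie

end

noncomputable section

namespace OmniLie

open scoped Convolution
open MeasureTheory Set

/-! ### Algebra of gauge operators and jets over an arbitrary commutative real algebra. -/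

section Algebra

variable {A : Type*} [CommRing A] [Algebra ℝ A]
  {S : Type*} [AddCommGroup S] [Module ℝ S] [Module A S] [IsScalarTower ℝ A S]

/-! Write `𝒥 = (N, π; 0, -N⋆)` and split its integrability defect along `𝔇E ⊕ 𝔍E`. The square
condition is `N² = -1` together with `Nπ = πN⋆`. When `N² = -1`, the gauge-gauge block of the defect
is the torsion of `N`. The jet-jet block is the pair formed by the failure of `π` to preserve
brackets and the concomitant of `(π, N)`. In the mixed block the jet part is the torsion of `N`
paired with a jet, and the gauge part is dual to the concomitant.

From (b) to (a) one reads components: the square gives `N² = -1` and the commutation, orthogonality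
gives skewness, and the jet part of the jet-jet block gives the concomitant.

From (a) to (b) two facts about `π` are missing from the hypotheses: it is skew, and it maps
`piBracket` to the commutator. Both are tensorial, so it is enough to check them on prolongations
`𝕕u`, where they are the skew-symmetry and the Jacobi identity of `E`. This reduction is
`LocallySpanned`: near each point some nonvanishing function multiplies every jet into the span of
the prolongations. The function is built in `mul_mem_spanningFunctions` from a local frame and local
coordinates. The coordinates must control abstract derivations of `C^∞(M)`, which is where
Hadamard's lemma enters.

Where the fibre of `E` is zero, a gauge operator is not determined by its action, since the symbol
is separate data. `gauge_eq_zero` deals with this, using that `C^∞(M)` is reduced. -/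

theorem gbr_skew (d t : Gauge A S) : gbr d t = -gbr t d :=
  (gaugeLieAlgebroid A S).bracket_skew d t

theorem gbr_smul_right (d : Gauge A S) (f : A) (t : Gauge A S) :
    gbr d (f • t) = f • gbr d t + Gauge.symbol d f • t :=
  (gaugeLieAlgebroid A S).leibniz d f t

theorem gbr_smul_left (f : A) (d t : Gauge A S) :
    gbr (f • d) t = f • gbr d t - Gauge.symbol t f • d := by
  rw [gbr_skew, gbr_smul_right, gbr_skew t d, smul_neg]
  abel

@[simp] theorem gbr_add_right (d t t' : Gauge A S) : gbr d (t + t') = gbr d t + gbr d t' :=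
  ((gaugeLieAlgebroid A S).bracket d).map_add t t'

@[simp] theorem gbr_add_left (d d' t : Gauge A S) : gbr (d + d') t = gbr d t + gbr d' t :=
  LinearMap.map_add₂ _ _ _ _

@[simp] theorem gbr_zero_right (d : Gauge A S) : gbr d 0 = 0 :=
  ((gaugeLieAlgebroid A S).bracket d).map_zero

@[simp] theorem gbr_zero_left (d : Gauge A S) : gbr 0 d = 0 := LinearMap.map_zero₂ _ _

theorem jet_ext {μ ν : Jet A S} (h : ∀ d, μ.1 d = ν.1 d) : μ = ν :=
  Subtype.ext (LinearMap.ext h)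

@[simp] theorem jet_add_apply (μ ν : Jet A S) (d : Gauge A S) : (μ + ν).1 d = μ.1 d + ν.1 d := rfl

@[simp] theorem jet_sub_apply (μ ν : Jet A S) (d : Gauge A S) : (μ - ν).1 d = μ.1 d - ν.1 d := rfl

@[simp] theorem jet_neg_apply (μ : Jet A S) (d : Gauge A S) : (-μ).1 d = -μ.1 d := rfl

@[simp] theorem jet_zero_apply (d : Gauge A S) : (0 : Jet A S).1 d = 0 := rfl

@[simp] theorem jet_smul_apply (f : A) (μ : Jet A S) (d : Gauge A S) :
    (f • μ).1 d = f • μ.1 d := rfl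

/-- The jet bundle map `π^♯` is skew-symmetric for the `E`-valued pairing. -/
def IsSkew (pi : Jet A S →ₗ[A] Gauge A S) : Prop :=
  ∀ μ ν : Jet A S, μ.1 (pi ν) = -ν.1 (pi μ)

/-! ### From a generalized complex structure to an algebroid-Nijenhuis structure -/

theorem omniPairing_eq_iff {x y x' y' : Omni A S} :
    omniPairing x y = omniPairing x' y' ↔
      x.2.1 y.1 + y.2.1 x.1 = x'.2.1 y'.1 + y'.2.1 x'.1 := by
  unfold omniPairing
  exact (smul_right_injective S (by norm_num : (1 / 2 : ℝ) ≠ 0)).eq_iff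

/-- Once `π N⋆` is rewritten as `N π`, the terms in which `N π μ` or `N π ν` acts as a Lie
derivative cancel. The result is the normal form against which the blocks of the integrability
defect are compared. -/
theorem concomitant_apply_of_comm {pi : Jet A S →ₗ[A] Gauge A S} {N : Gauge A S →ₗ[A] Gauge A S}
    {hN : PreservesJet N} (hcomm : ∀ ν, N (pi ν) = pi (jetStar N hN ν))
    (μ ν : Jet A S) (d : Gauge A S) :
    (concomitant pi N hN μ ν).1 d =
      ν.1 (N (gbr (pi μ) d)) - μ.1 (N (gbr (pi ν) d)) + Gauge.act d (ν.1 (N (pi μ)))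
        - ν.1 (gbr (pi μ) (N d)) + μ.1 (gbr (pi ν) (N d)) - Gauge.act (N d) (ν.1 (pi μ)) := by
  simp only [concomitant, piBracket, LinearMap.comp_apply, hcomm, jet_add_apply, jet_sub_apply,
    lieDer_apply, jetd_apply, jetStar_apply]
  abel

theorem jetStar_jetStar {N : Gauge A S →ₗ[A] Gauge A S} {hN : PreservesJet N}
    (hsq : ∀ d, N (N d) = -d) (μ : Jet A S) : jetStar N hN (jetStar N hN μ) = -μ :=
  jet_ext fun d => by simp [hsq]

/-- Purely algebraic: skewness of `π` comes from orthogonality here, so no local spanning by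
prolongations is needed. -/
theorem isAlgebroidNijenhuis_of_isGeneralizedComplex {𝓔 : LieAlgebroid A S}
    {pi : Jet A S →ₗ[A] Gauge A S} (hpi : IsInducedBy 𝓔 pi) {N : Gauge A S →ₗ[A] Gauge A S}
    (hnij : IsNijenhuis (gaugeLieAlgebroid A S) N) {hN : PreservesJet N}
    (hJ : IsGeneralizedComplex (omniMatrix N hN pi)) :
    IsAlgebroidNijenhuis 𝓔 pi N ∧ ∀ d, N (N d) = -d := by
  have hsq : ∀ d, N (N d) = -d := fun d => by
    have h := congrArg Prod.fst (hJ.sq (d, 0))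
    simpa using h
  have hcomm : ∀ ν, N (pi ν) = pi (jetStar N hN ν) := fun ν => by
    have h := congrArg Prod.fst (hJ.sq (0, ν))
    simp only [omniMatrix_apply, map_zero, zero_add, map_neg, Prod.fst_neg, neg_zero] at h
    exact add_neg_eq_zero.1 h
  have hskewN : ∀ μ ν : Jet A S, μ.1 (N (pi ν)) = -ν.1 (N (pi μ)) := fun μ ν => by
    have h := omniPairing_eq_iff.1 (hJ.orthogonal (0, μ) (0, ν))
    simp only [omniMatrix_apply, map_zero, zero_add, jet_neg_apply, jetStar_apply, add_zero] at h
    rw [← neg_eq_iff_add_eq_zero, neg_neg] at h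
    exact h
  have hskew : IsSkew pi := fun μ ν => by
    -- Orthogonality only sees `N π`; inserting `N⋆μ` and using `N² = -1` strips off the factor `N`.
    have h := hskewN (jetStar N hN μ) ν
    rw [jetStar_apply, hsq, ← hcomm, hsq, map_neg, map_neg, neg_neg] at h
    rw [← h, neg_neg]
  refine ⟨⟨hpi, hnij, hN, LinearMap.ext hcomm, fun μ ν => jet_ext fun d => ?_⟩, hsq⟩
  -- The jet component on two pure jets is exactly the concomitant.
  have h := congrArg (fun x : Omni A S => x.2.1 d) (hJ.integrable (0, μ) (0, ν))
  simp only [dorfman, omniMatrix_apply, Prod.snd_sub, Prod.mk_add_mk, map_zero,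
    zero_add, jet_sub_apply, jet_add_apply, jet_neg_apply, lieDer_apply, jetd_apply, jetStar_apply,
    Prod.snd_zero, jet_zero_apply, gbr_zero_left, Gauge.act_neg_right, hskew μ ν, hskewN μ ν] at h
  rw [concomitant_apply_of_comm hcomm, jet_zero_apply, ← h]
  have h0 : ∀ u : S, Gauge.act (0 : Gauge A S) u = 0 := fun _ => rfl
  simp only [h0, Gauge.act_zero_right]
  abel

/-! ### Consequences of jets being locally spanned by prolongations -/

variable (A S) in
/-- The functions that multiply every jet into the span of the prolongations of sections. -/
def spanningFunctions : Set A :=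
  {k | ∀ μ : Jet A S, k • μ ∈ Submodule.span A (Set.range (jetd : S → Jet A S))}

variable (A S) in
/-- Jets are locally spanned by prolongations: functions and sections annihilated by all
spanning functions vanish. -/
structure LocallySpanned : Prop where
  function : ∀ a : A, (∀ k ∈ spanningFunctions A S, k * a = 0) → a = 0
  section' : ∀ s : S, (∀ k ∈ spanningFunctions A S, k • s = 0) → s = 0

theorem LocallySpanned.gauge (hS : LocallySpanned A S) (D : Gauge A S)
    (h : ∀ k ∈ spanningFunctions A S, k • D = 0) : D = 0 := by
  apply Gauge.ext
  · intro u
    exact hS.section' _ fun k hk => congrArg (fun D => Gauge.act D u) (h k hk)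
  · ext f
    refine hS.function _ fun k hk => ?_
    have := congrArg (fun D => Gauge.symbol D f) (h k hk)
    simpa using this

/-- After multiplication by a spanning function `k`, the jet lies in the span of prolongations,
where the two linear maps agree; the factor `k` is then removed by local spanning. -/
theorem LocallySpanned.ext_section (hS : LocallySpanned A S) {φ ψ : Jet A S →ₗ[A] S}
    (h : ∀ u, φ (jetd u) = ψ (jetd u)) : φ = ψ := by
  ext μ
  rw [← sub_eq_zero]
  refine hS.section' _ fun k hk => ?_
  rw [smul_sub, ← map_smul, ← map_smul, sub_eq_zero]
  exact LinearMap.eqOn_span (by rintro _ ⟨u, rfl⟩; exact h u) (hk μ)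

theorem LocallySpanned.ext_gauge (hS : LocallySpanned A S) {φ ψ : Jet A S →ₗ[A] Gauge A S}
    (h : ∀ u, φ (jetd u) = ψ (jetd u)) : φ = ψ := by
  ext1 μ
  rw [← sub_eq_zero]
  refine hS.gauge _ fun k hk => ?_
  rw [smul_sub, ← map_smul, ← map_smul, sub_eq_zero]
  exact LinearMap.eqOn_span (by rintro _ ⟨u, rfl⟩; exact h u) (hk μ)

theorem act_ad (𝓔 : LieAlgebroid A S) (u v : S) : Gauge.act (ad 𝓔 u) v = 𝓔.bracket u v := rfl

/-- On two prolongations this is the skew-symmetry of the bracket of `E`. Linearity extends it in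
one argument at a time. -/
theorem isSkew_of_isInducedBy (hS : LocallySpanned A S) {𝓔 : LieAlgebroid A S}
    {pi : Jet A S →ₗ[A] Gauge A S} (hpi : IsInducedBy 𝓔 pi) : IsSkew pi := by
  have h1 : ∀ u (ν : Jet A S), Gauge.act (pi ν) u = -ν.1 (pi (jetd u)) := fun u ν => by
    have := hS.ext_section (φ := (jetd u : Jet A S).1 ∘ₗ pi)
      (ψ := -(LinearMap.applyₗ (pi (jetd u)) ∘ₗ (Jet A S).subtype)) (fun v => by
        change Gauge.act (pi (jetd v)) u = -Gauge.act (pi (jetd u)) v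
        rw [hpi, hpi, act_ad, act_ad, 𝓔.bracket_skew])
    exact LinearMap.congr_fun this ν
  intro μ ν
  have := hS.ext_section (φ := LinearMap.applyₗ (pi ν) ∘ₗ (Jet A S).subtype)
    (ψ := -(ν.1 ∘ₗ pi)) (h1 · ν)
  exact LinearMap.congr_fun this μ

/-- The map `u ↦ d(f u) - f du`, as a jet. -/
def dtensor (f : A) (u : S) : Jet A S := jetd (f • u) - f • jetd u

theorem dtensor_apply (f : A) (u : S) (d : Gauge A S) :
    (dtensor f u).1 d = Gauge.symbol d f • u := by
  simp [dtensor, Gauge.act_smul_right]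

theorem lieDer_smul_right (d : Gauge A S) (f : A) (ν : Jet A S) :
    lieDer d (f • ν) = f • lieDer d ν + Gauge.symbol d f • ν := by
  refine jet_ext fun t => ?_
  simp only [lieDer_apply, jet_add_apply, jet_smul_apply, Gauge.act_smul_right, smul_sub]
  abel

theorem lieDer_smul_left (f : A) (d : Gauge A S) (ν : Jet A S) :
    lieDer (f • d) ν = f • lieDer d ν + dtensor f (ν.1 d) := by
  refine jet_ext fun t => ?_
  simp only [lieDer_apply, jet_add_apply, jet_smul_apply, Gauge.act_smul, smul_sub,
    gbr_smul_left, map_sub, map_smul, dtensor_apply]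
  abel

theorem lieDer_add_left (d d' : Gauge A S) (ν : Jet A S) :
    lieDer (d + d') ν = lieDer d ν + lieDer d' ν := by
  refine jet_ext fun t => ?_
  simp only [lieDer_apply, jet_add_apply, Gauge.act_add, gbr_add_left, map_add]
  abel

theorem lieDer_add_right (d : Gauge A S) (μ ν : Jet A S) :
    lieDer d (μ + ν) = lieDer d μ + lieDer d ν := by
  refine jet_ext fun t => ?_
  simp only [lieDer_apply, jet_add_apply, Gauge.act_add_right]
  abel

theorem jetd_add (u v : S) : (jetd (u + v) : Jet A S) = jetd u + jetd v :=
  jet_ext fun d => Gauge.act_add_right d u v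

theorem piBracket_add_right (pi : Jet A S →ₗ[A] Gauge A S) (μ ν ν' : Jet A S) :
    piBracket pi μ (ν + ν') = piBracket pi μ ν + piBracket pi μ ν' := by
  simp only [piBracket, map_add, lieDer_add_left, lieDer_add_right, jet_add_apply, jetd_add]
  abel

/-- The Lie derivative along `f • π ν` and the prolongation of `f • ν(π μ)` each produce a `dtensor
f` term; skewness makes the two cancel, leaving a clean Leibniz rule. -/
theorem piBracket_smul_right {pi : Jet A S →ₗ[A] Gauge A S} (hskew : IsSkew pi) (μ ν : Jet A S)
    (f : A) : piBracket pi μ (f • ν) =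
      f • piBracket pi μ ν + Gauge.symbol (pi μ) f • ν := by
  have h : (jetd (f • ν.1 (pi μ)) : Jet A S) =
      f • jetd (ν.1 (pi μ)) + dtensor f (ν.1 (pi μ)) := by simp [dtensor]
  have h' : dtensor f (μ.1 (pi ν)) = -dtensor f (ν.1 (pi μ)) :=
    jet_ext fun d => by simp [dtensor_apply, hskew μ ν]
  simp only [piBracket, map_smul, lieDer_smul_left, lieDer_smul_right, jet_smul_apply, h, h',
    smul_sub]
  abel

theorem piBracket_skew {pi : Jet A S →ₗ[A] Gauge A S} (hskew : IsSkew pi) (μ ν : Jet A S) :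
    piBracket pi μ ν = -piBracket pi ν μ := by
  refine jet_ext fun d => ?_
  simp only [piBracket, hskew μ ν, jet_sub_apply, jet_neg_apply, jetd_apply, Gauge.act_neg_right]
  abel

/-- The failure of `π^♯` to preserve brackets, as a bundle map in its second argument. -/
def bracketDefect {pi : Jet A S →ₗ[A] Gauge A S} (hskew : IsSkew pi) (μ : Jet A S) :
    Jet A S →ₗ[A] Gauge A S where
  toFun ν := gbr (pi μ) (pi ν) - pi (piBracket pi μ ν)
  map_add' ν ν' := by
    simp only [map_add, gbr_add_right, piBracket_add_right]
    abel
  map_smul' f ν := by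
    simp only [map_smul, map_add, gbr_smul_right, piBracket_smul_right hskew, RingHom.id_apply,
      smul_sub]
    abel

theorem bracketDefect_skew {pi : Jet A S →ₗ[A] Gauge A S} (hskew : IsSkew pi) (μ ν : Jet A S) :
    bracketDefect hskew μ ν = -bracketDefect hskew ν μ := by
  change gbr (pi μ) (pi ν) - pi (piBracket pi μ ν) =
    -(gbr (pi ν) (pi μ) - pi (piBracket pi ν μ))
  rw [gbr_skew, piBracket_skew hskew, map_neg]
  abel

theorem piBracket_jetd {𝓔 : LieAlgebroid A S} {pi : Jet A S →ₗ[A] Gauge A S}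
    (hpi : IsInducedBy 𝓔 pi) (u v : S) :
    piBracket pi (jetd u) (jetd v) = jetd (𝓔.bracket u v) := by
  refine jet_ext fun d => ?_
  simp only [piBracket, hpi u, hpi v, jet_sub_apply, lieDer_apply, jetd_apply, act_gbr, act_ad]
  rw [𝓔.bracket_skew v u, Gauge.act_neg_right]
  abel

/-- An operator that acts by zero vanishes, if functions annihilating all sections kill it. -/
theorem gauge_eq_zero [IsReduced A] {D : Gauge A S} (hact : ∀ u, Gauge.act D u = 0)
    (hann : ∀ a : A, (∀ u : S, a • u = 0) → a • D = 0) : D = 0 := by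
  refine Gauge.ext hact (Derivation.ext fun f => ?_)
  -- With zero action, the Leibniz rule makes `X f` annihilate all sections, where `X` is the
  -- symbol. Then `hann` gives `X f • D = 0`, whose symbol at `f` is `(X f)² = 0`.
  have h : ∀ u : S, Gauge.symbol D f • u = 0 := fun u => by
    have := Gauge.act_smul_right D f u
    rwa [hact, hact, smul_zero, zero_add, eq_comm] at this
  have h2 := congrArg (fun D => Gauge.symbol D f) (hann _ h)
  simp only [map_smul, Derivation.smul_apply, map_zero, Derivation.zero_apply, smul_eq_mul] at h2
  exact IsReduced.eq_zero _ ⟨2, (pow_two _).trans h2⟩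

/-- The actions agree by the Jacobi identity. The symbols then agree, so that the anchor preserves
brackets, because a function annihilating all sections also annihilates every anchor. -/
theorem gbr_ad [IsReduced A] (𝓔 : LieAlgebroid A S) (u v : S) :
    gbr (ad 𝓔 u) (ad 𝓔 v) = ad 𝓔 (𝓔.bracket u v) := by
  rw [← sub_eq_zero]
  refine gauge_eq_zero (fun w => ?_) fun a ha => ?_
  · change 𝓔.bracket u (𝓔.bracket v w) - 𝓔.bracket v (𝓔.bracket u w)
      - 𝓔.bracket (𝓔.bracket u v) w = 0
    rw [𝓔.jacobi]
    abel
  · apply Gauge.ext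
    · intro w
      exact ha _
    · ext f
      have h : ∀ w g, a * 𝓔.anchor w g = 0 := fun w g => by
        rw [← smul_eq_mul, ← Derivation.smul_apply, ← map_smul, ha, map_zero, Derivation.zero_apply]
      change a * (⁅𝓔.anchor u, 𝓔.anchor v⁆ f - 𝓔.anchor (𝓔.bracket u v) f) = 0
      rw [Derivation.commutator_apply, mul_sub, mul_sub, h, h, h]
      simp

/-- The defect is linear in its second argument and skew, hence tensorial in both, and on
prolongations it vanishes by `piBracket_jetd` and `gbr_ad`. -/
theorem gbr_pi_pi [IsReduced A] (hS : LocallySpanned A S) {𝓔 : LieAlgebroid A S}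
    {pi : Jet A S →ₗ[A] Gauge A S} (hpi : IsInducedBy 𝓔 pi) (μ ν : Jet A S) :
    gbr (pi μ) (pi ν) = pi (piBracket pi μ ν) := by
  have hskew := isSkew_of_isInducedBy hS hpi
  have h1 : ∀ u, bracketDefect hskew (jetd u) = 0 := fun u => hS.ext_gauge fun v => by
    change gbr (pi (jetd u)) (pi (jetd v)) - pi (piBracket pi (jetd u) (jetd v)) = 0
    rw [piBracket_jetd hpi, hpi, hpi, hpi, gbr_ad, sub_self]
  have h2 : bracketDefect hskew μ = 0 := hS.ext_gauge fun u => by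
    rw [bracketDefect_skew, h1, LinearMap.zero_apply, neg_zero, LinearMap.zero_apply]
  exact sub_eq_zero.1 (LinearMap.congr_fun h2 ν)

/-! ### From an algebroid-Nijenhuis structure to a generalized complex structure -/

/-- Testing the left side against `𝕕u` and moving `π` across the pairing by skewness gives, up to
sign, the concomitant of `𝕕u` and `ν` evaluated at `d`. -/
theorem gbr_mixed [IsReduced A] {pi : Jet A S →ₗ[A] Gauge A S} (hskew : IsSkew pi)
    {N : Gauge A S →ₗ[A] Gauge A S} {hN : PreservesJet N}
    (hcomm : ∀ ν, N (pi ν) = pi (jetStar N hN ν))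
    (hconc : ∀ μ ν, concomitant pi N hN μ ν = 0) (d : Gauge A S) (ν : Jet A S) :
    gbr (N d) (pi ν) - N (gbr d (pi ν))
      - pi (lieDer (N d) ν - lieDer d (jetStar N hN ν)) = 0 := by
  refine gauge_eq_zero (fun u => ?_) fun a ha => ?_
  · have h := congrArg (fun μ : Jet A S => μ.1 d) (hconc (jetd u) ν)
    rw [concomitant_apply_of_comm hcomm] at h
    change (jetd u : Jet A S).1 (gbr (N d) (pi ν) - N (gbr d (pi ν))
      - pi (lieDer (N d) ν - lieDer d (jetStar N hN ν))) = 0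
    rw [map_sub, map_sub, hskew (jetd u), gbr_skew (N d), gbr_skew d, ← neg_eq_zero]
    refine Eq.trans ?_ h
    simp only [jet_sub_apply, lieDer_apply, jetStar_apply, map_neg, gbr_skew (N d) (pi (jetd u)),
      gbr_skew d (pi (jetd u))]
    abel
  · have hjet : ∀ μ : Jet A S, a • μ = 0 := fun μ => jet_ext fun t => ha _
    have hpi : a • pi ν = 0 := by rw [← map_smul, hjet, map_zero]
    -- If `a` annihilates all sections then so does its derivative along any symbol, so the extra
    -- Leibniz term also vanishes.
    have hsymb : ∀ t : Gauge A S, a • gbr t (pi ν) = 0 := fun t => by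
      have hX : ∀ u : S, Gauge.symbol t a • u = 0 := fun u => by
        have := Gauge.act_smul_right t a u
        rwa [ha, ha, Gauge.act_zero_right, zero_add, eq_comm] at this
      have hX' : Gauge.symbol t a • pi ν = 0 := by
        rw [← map_smul, show Gauge.symbol t a • ν = 0 from jet_ext fun t => hX _, map_zero]
      have := gbr_smul_right t a (pi ν)
      rwa [hpi, gbr_zero_right, hX', add_zero, eq_comm] at this
    rw [smul_sub, smul_sub, hsymb, ← map_smul, hsymb, ← map_smul, hjet]
    simp only [map_zero, sub_zero]

theorem dorfman_add_left (x x' y : Omni A S) : dorfman (x + x') y = dorfman x y + dorfman x' y := by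
  refine Prod.ext (gbr_add_left _ _ _) ?_
  simp only [dorfman, Prod.fst_add, Prod.snd_add, lieDer_add_left, lieDer_add_right, jet_add_apply,
    jetd_add]
  abel

theorem dorfman_add_right (x y y' : Omni A S) :
    dorfman x (y + y') = dorfman x y + dorfman x y' := by
  refine Prod.ext (gbr_add_right _ _ _) ?_
  simp only [dorfman, Prod.fst_add, Prod.snd_add, lieDer_add_left, lieDer_add_right, map_add,
    jetd_add]
  abel

/-- The integrability defect of a bundle map of `ol(E)`. -/
def courantNijenhuis (J : Omni A S →ₗ[A] Omni A S) (x y : Omni A S) : Omni A S :=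
  dorfman (J x) (J y) - dorfman x y - J (dorfman (J x) y + dorfman x (J y))

theorem courantNijenhuis_add_left (J : Omni A S →ₗ[A] Omni A S) (x x' y : Omni A S) :
    courantNijenhuis J (x + x') y = courantNijenhuis J x y + courantNijenhuis J x' y := by
  simp only [courantNijenhuis, map_add, dorfman_add_left]
  abel

theorem courantNijenhuis_add_right (J : Omni A S →ₗ[A] Omni A S) (x y y' : Omni A S) :
    courantNijenhuis J x (y + y') = courantNijenhuis J x y + courantNijenhuis J x y' := by
  simp only [courantNijenhuis, map_add, dorfman_add_right]
  abel

theorem dorfman_skew {x y : Omni A S} : dorfman x y + dorfman y x =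
    (0, jetd (x.2.1 y.1 + y.2.1 x.1)) := by
  refine Prod.ext ?_ ?_
  · change gbr x.1 y.1 + gbr y.1 x.1 = 0
    rw [gbr_skew, neg_add_cancel]
  · simp only [dorfman, Prod.snd_add, jetd_add]
    abel

/-- The integrability defect is skew-symmetric for orthogonal almost complex structures. -/
theorem courantNijenhuis_skew {J : Omni A S →ₗ[A] Omni A S} (hsq : ∀ x, J (J x) = -x)
    (horth : ∀ x y, omniPairing (J x) (J y) = omniPairing x y) (x y : Omni A S) :
    courantNijenhuis J x y = -courantNijenhuis J y x := by
  rw [eq_neg_iff_add_eq_zero]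
  have e1 := omniPairing_eq_iff.1 (horth x y)
  have e2 := omniPairing_eq_iff.1 (horth (J x) y)
  rw [hsq] at e2
  have h1 := dorfman_skew (x := J x) (y := J y)
  have h2 := dorfman_skew (x := x) (y := y)
  have h3 := dorfman_skew (x := J x) (y := y)
  have h4 := dorfman_skew (x := J y) (y := x)
  -- The symmetric part of the bracket is the prolongation of twice the pairing. Orthogonality and
  -- `J² = -1` make `J` skew for the pairing, so the two prolongations cancel.
  have h5 : (dorfman (J x) y + dorfman y (J x)) + (dorfman (J y) x + dorfman x (J y)) = 0 := by
    rw [h3, h4, ← e2, Prod.mk_add_mk, ← jetd_add, add_zero]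
    have : (-x).2.1 (J y).1 + (J y).2.1 (-x).1 + ((J y).2.1 x.1 + x.2.1 (J y).1) = 0 := by
      simp only [Prod.snd_neg, Prod.fst_neg, jet_neg_apply, map_neg]
      abel
    rw [this]
    exact Prod.ext rfl (jet_ext fun t => Gauge.act_zero_right t)
  have h6 : courantNijenhuis J x y + courantNijenhuis J y x =
      (dorfman (J x) (J y) + dorfman (J y) (J x)) - (dorfman x y + dorfman y x)
      - J ((dorfman (J x) y + dorfman y (J x)) + (dorfman (J y) x + dorfman x (J y))) := by
    simp only [courantNijenhuis, map_add]
    abel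
  rw [h6, h5, h1, h2, e1, map_zero]
  simp

theorem lieDer_zero_right (t : Gauge A S) : lieDer t 0 = 0 :=
  jet_ext fun s => by simp

theorem lieDer_zero_left (μ : Jet A S) : lieDer 0 μ = 0 := by
  refine jet_ext fun s => ?_
  rw [lieDer_apply, gbr_zero_left, map_zero, sub_zero]
  rfl

theorem lieDer_neg_right (t : Gauge A S) (μ : Jet A S) : lieDer t (-μ) = -lieDer t μ := by
  refine jet_ext fun s => ?_
  simp only [lieDer_apply, jet_neg_apply, Gauge.act_neg_right]
  abel

theorem jetd_zero : (jetd (0 : S) : Jet A S) = 0 := jet_ext Gauge.act_zero_right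

theorem IsNijenhuis.gbr_of_sq {N : Gauge A S →ₗ[A] Gauge A S}
    (h : IsNijenhuis (gaugeLieAlgebroid A S) N) (hsq : ∀ d, N (N d) = -d) (d t : Gauge A S) :
    gbr (N d) (N t) - N (gbr (N d) t) - N (gbr d (N t)) - gbr d t = 0 := by
  have := h d t
  change gbr (N d) (N t) - N (gbr (N d) t + gbr d (N t) - N (gbr d t)) = 0 at this
  rw [← this, map_sub, map_add, hsq]
  abel

theorem omniMatrix_sq {pi : Jet A S →ₗ[A] Gauge A S} {N : Gauge A S →ₗ[A] Gauge A S}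
    {hN : PreservesJet N} (hcomm : ∀ ν, N (pi ν) = pi (jetStar N hN ν))
    (hsq : ∀ d, N (N d) = -d) (x : Omni A S) :
    omniMatrix N hN pi (omniMatrix N hN pi x) = -x := by
  obtain ⟨d, μ⟩ := x
  refine Prod.ext ?_ ?_
  · simp [hsq, hcomm]
  · simp [jetStar_jetStar hsq]

/-- The gauge-jet terms are preserved because `N² = -1`; the jet-jet terms cancel because `N π`
inherits skewness from `π` through the commutation. -/
theorem omniMatrix_orthogonal {pi : Jet A S →ₗ[A] Gauge A S} (hskew : IsSkew pi)
    {N : Gauge A S →ₗ[A] Gauge A S} {hN : PreservesJet N}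
    (hcomm : ∀ ν, N (pi ν) = pi (jetStar N hN ν)) (hsq : ∀ d, N (N d) = -d) (x y : Omni A S) :
    omniPairing (omniMatrix N hN pi x) (omniMatrix N hN pi y) = omniPairing x y := by
  obtain ⟨d, μ⟩ := x
  obtain ⟨t, ν⟩ := y
  have hskewN : μ.1 (N (pi ν)) = -ν.1 (N (pi μ)) := by
    rw [hcomm μ, hskew ν, neg_neg]
    rfl
  refine omniPairing_eq_iff.2 ?_
  simp only [omniMatrix_apply, jet_neg_apply, jetStar_apply, map_add, hsq, map_neg, hskewN]
  abel

theorem courantNijenhuis_gauge_gauge {pi : Jet A S →ₗ[A] Gauge A S}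
    {N : Gauge A S →ₗ[A] Gauge A S} (hnij : IsNijenhuis (gaugeLieAlgebroid A S) N)
    {hN : PreservesJet N} (hsq : ∀ d, N (N d) = -d) (d t : Gauge A S) :
    courantNijenhuis (omniMatrix N hN pi) (d, 0) (t, 0) = 0 := by
  refine Prod.ext (Eq.trans ?_ (hnij.gbr_of_sq hsq d t)) ?_
  · simp only [courantNijenhuis, dorfman, omniMatrix_apply, map_zero, add_zero, Prod.fst_sub,
      Prod.mk_add_mk, neg_zero, lieDer_zero_right, jetd_zero, sub_zero, jet_zero_apply, map_add]
    abel
  · simp [courantNijenhuis, dorfman, lieDer_zero_right, jetd_zero]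

/-- The gauge component is `gbr_mixed`; the jet component at `t` is, up to sign, `ν` applied to the
torsion of `N` at `(d, t)`. -/
theorem courantNijenhuis_gauge_jet [IsReduced A] {pi : Jet A S →ₗ[A] Gauge A S}
    (hskew : IsSkew pi) {N : Gauge A S →ₗ[A] Gauge A S}
    (hnij : IsNijenhuis (gaugeLieAlgebroid A S) N) {hN : PreservesJet N}
    (hcomm : ∀ ν, N (pi ν) = pi (jetStar N hN ν))
    (hconc : ∀ μ ν, concomitant pi N hN μ ν = 0) (hsq : ∀ d, N (N d) = -d)
    (d : Gauge A S) (ν : Jet A S) :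
    courantNijenhuis (omniMatrix N hN pi) (d, 0) (0, ν) = 0 := by
  refine Prod.ext (Eq.trans ?_ (gbr_mixed hskew hcomm hconc d ν)) (jet_ext fun t => ?_)
  · simp only [courantNijenhuis, dorfman, omniMatrix_apply, map_zero, add_zero, zero_add,
      Prod.fst_sub, Prod.mk_add_mk, neg_zero, lieDer_zero_right, jetd_zero, sub_zero,
      jet_zero_apply, gbr_zero_right, lieDer_neg_right, map_add, map_sub, map_neg]
    abel
  · have hν := congrArg ν.1 (hnij.gbr_of_sq hsq d t)
    simp only [map_sub, map_zero] at hν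
    simp only [courantNijenhuis, dorfman, omniMatrix_apply, map_zero, add_zero, zero_add,
      Prod.snd_sub, Prod.mk_add_mk, neg_zero, lieDer_zero_right, jetd_zero, sub_zero,
      jet_zero_apply, jet_sub_apply, jet_neg_apply, jet_add_apply, lieDer_apply, jetStar_apply,
      Gauge.act_neg_right, Prod.snd_zero, hsq, map_neg]
    rw [← neg_zero, ← hν]
    abel

theorem courantNijenhuis_jet_jet {pi : Jet A S →ₗ[A] Gauge A S}
    (hskew : IsSkew pi) (hbr : ∀ μ ν, gbr (pi μ) (pi ν) = pi (piBracket pi μ ν))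
    {N : Gauge A S →ₗ[A] Gauge A S} {hN : PreservesJet N}
    (hcomm : ∀ ν, N (pi ν) = pi (jetStar N hN ν))
    (hconc : ∀ μ ν, concomitant pi N hN μ ν = 0) (μ ν : Jet A S) :
    courantNijenhuis (omniMatrix N hN pi) (0, μ) (0, ν) = 0 := by
  have hJ : courantNijenhuis (omniMatrix N hN pi) (0, μ) (0, ν) =
      (gbr (pi μ) (pi ν) - pi (piBracket pi μ ν), concomitant pi N hN μ ν) := by
    have hμν : piBracket pi μ ν = lieDer (pi μ) ν - lieDer (pi ν) μ + jetd (μ.1 (pi ν)) :=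
      jet_ext fun d => by
        simp only [piBracket, hskew μ ν, jet_sub_apply, jet_add_apply, jetd_apply,
          Gauge.act_neg_right]
        abel
    refine Prod.ext ?_ (jet_ext fun d => ?_)
    · simp only [courantNijenhuis, dorfman, omniMatrix_apply, map_zero, zero_add, Prod.fst_sub,
        Prod.mk_add_mk, lieDer_zero_left, jetd_zero, sub_zero, zero_sub, add_zero,
        gbr_zero_left, gbr_zero_right, map_add, map_sub, map_neg, hμν]
      abel
    · have hskewN : μ.1 (N (pi ν)) = -ν.1 (N (pi μ)) := by
        rw [hcomm μ, hskew ν, neg_neg]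
        rfl
      rw [concomitant_apply_of_comm hcomm]
      simp only [courantNijenhuis, dorfman, omniMatrix_apply, map_zero, zero_add, Prod.snd_sub,
        Prod.mk_add_mk, lieDer_zero_left, jetd_zero, sub_zero, zero_sub, add_zero, jet_sub_apply,
        jet_add_apply, jet_neg_apply, lieDer_apply, jetd_apply, jetStar_apply,
        Gauge.act_neg_right, hskew μ ν, hskewN]
      abel
  rw [hJ, hbr, hconc, sub_self]
  rfl

/-- The defect is biadditive, so its blocks suffice, and its skewness reduces the jet-gauge block to
the gauge-jet block. -/
theorem isGeneralizedComplex_of_isAlgebroidNijenhuis [IsReduced A] (hS : LocallySpanned A S)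
    {𝓔 : LieAlgebroid A S} {pi : Jet A S →ₗ[A] Gauge A S} {N : Gauge A S →ₗ[A] Gauge A S}
    (h : IsAlgebroidNijenhuis 𝓔 pi N) (hsq : ∀ d, N (N d) = -d) :
    IsGeneralizedComplex (omniMatrix N h.preservesJet pi) := by
  have hskew := isSkew_of_isInducedBy hS h.induced
  have hcomm : ∀ ν, N (pi ν) = pi (jetStar N h.preservesJet ν) := LinearMap.congr_fun h.comm
  have hJsq := omniMatrix_sq hcomm hsq
  have horth := omniMatrix_orthogonal hskew hcomm hsq
  have hgj := courantNijenhuis_gauge_jet hskew h.nijenhuis hcomm h.concomitant_eq_zero hsq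
  refine ⟨hJsq, horth, ?_⟩
  rintro ⟨d, μ⟩ ⟨t, ν⟩
  change courantNijenhuis (omniMatrix N h.preservesJet pi) (d, μ) (t, ν) = 0
  have hx : ((d, μ) : Omni A S) = (d, 0) + (0, μ) := by simp
  have hy : ((t, ν) : Omni A S) = (t, 0) + (0, ν) := by simp
  rw [hx, hy, courantNijenhuis_add_left, courantNijenhuis_add_right, courantNijenhuis_add_right,
    courantNijenhuis_gauge_gauge h.nijenhuis hsq, hgj,
    courantNijenhuis_jet_jet hskew (gbr_pi_pi hS h.induced) hcomm h.concomitant_eq_zero,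
    courantNijenhuis_skew hJsq horth (0, μ) (t, 0), hgj, neg_zero, add_zero, add_zero]

/-! ### Spanning functions from local frames and local coordinates -/

/-- The operator `u ↦ ∑ a, X (c a u) • e a` obtained by differentiating the components `c a u` of a
section in a local frame `e`; here `∑ a, c a u • e a = g • u`. -/
def frameConnection {α : Type*} [Fintype α] {g : A} {c : α → S →ₗ[A] A} {e : α → S}
    (hframe : ∀ u, ∑ a, c a u • e a = g • u) (X : Derivation ℝ A A) : Gauge A S :=
  ⟨({ toFun := fun u => ∑ a, X (c a u) • e a
      map_add' := fun u v => by simp [add_smul, Finset.sum_add_distrib]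
      map_smul' := fun r u => by
        rw [RingHom.id_apply, Finset.smul_sum]
        refine Finset.sum_congr rfl fun a _ => ?_
        rw [← algebraMap_smul A r u, map_smul, algebraMap_smul, X.map_smul, smul_assoc] }, g • X), by
    intro f u
    change ∑ a, X (c a (f • u)) • e a = f • ∑ a, X (c a u) • e a + (g * X f) • u
    rw [mul_comm, mul_smul, ← hframe u, Finset.smul_sum, Finset.smul_sum,
      ← Finset.sum_add_distrib]
    refine Finset.sum_congr rfl fun a _ => ?_
    rw [map_smul, smul_eq_mul, Derivation.leibniz, add_smul, smul_eq_mul, smul_eq_mul, smul_smul,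
      smul_smul, mul_comm (c a u), add_comm]⟩

/-- A frame and coordinates split `𝔇E` locally into endomorphisms and frame connections. A jet is
determined on endomorphisms by its value at the identity, so both parts give explicit combinations
of prolongations. -/
theorem mul_mem_spanningFunctions {α ι : Type*} [Fintype α] [Fintype ι] {g h : A}
    {c : α → S →ₗ[A] A} {e : α → S} (hframe : ∀ u, ∑ a, c a u • e a = g • u)
    {X : ι → Derivation ℝ A A} {x : ι → A}
    (hcoord : ∀ (Y : Derivation ℝ A A) (f : A), h * Y f = ∑ i, X i f * Y (x i)) :
    h * g ∈ spanningFunctions A S := by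
  intro μ
  -- Obtained by applying `d` to `∑ a, c a u • e a = g • u`, multiplying by `h`, and expanding the
  -- derivatives of the components in coordinates.
  have hd : ∀ d : Gauge A S, (h * g) • d =
      Gauge.ofEnd (h • (∑ a, (c a).smulRight (Gauge.act d (e a)) -
        Gauge.symbol d g • LinearMap.id))
      + ∑ i, Gauge.symbol d (x i) • frameConnection hframe (X i) := by
    intro d
    apply Gauge.ext
    · intro u
      have hu := congrArg (fun v => h • Gauge.act d v) (hframe u)
      have hsum : ∀ v : α → S, Gauge.act d (∑ a, v a) = ∑ a, Gauge.act d (v a) := fun v =>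
        map_sum d.1.1 v _
      have hsum' : Gauge.act (∑ i, Gauge.symbol d (x i) • frameConnection hframe (X i)) u =
          ∑ a, (∑ i, X i (c a u) * Gauge.symbol d (x i)) • e a := by
        have : Gauge.act (∑ i, Gauge.symbol d (x i) • frameConnection hframe (X i)) u =
            ∑ i, Gauge.symbol d (x i) • ∑ a, X i (c a u) • e a :=
          map_sum (jetd u : Jet A S).1 _ _
        rw [this]
        simp only [Finset.smul_sum, Finset.sum_smul]
        rw [Finset.sum_comm]
        refine Finset.sum_congr rfl fun a _ => Finset.sum_congr rfl fun i _ => ?_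
        rw [smul_smul, mul_comm]
      simp only [hsum, Gauge.act_smul_right, Finset.sum_add_distrib, smul_add] at hu
      rw [Gauge.act_add, hsum']
      simp only [← hcoord, Gauge.act_smul, Gauge.act_ofEnd, LinearMap.smul_apply,
        LinearMap.sub_apply, LinearMap.sum_apply, LinearMap.smulRight_apply, LinearMap.id_apply,
        mul_smul, ← Finset.smul_sum, smul_sub]
      rw [sub_add_eq_add_sub, hu, add_sub_cancel_right]
    · ext f
      have hsymb : Gauge.symbol (∑ i, Gauge.symbol d (x i) • frameConnection hframe (X i)) =
          ∑ i, Gauge.symbol d (x i) • g • X i := map_sum Gauge.symbol _ _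
      have hsum : (∑ i, Gauge.symbol d (x i) • g • X i) f =
          ∑ i, Gauge.symbol d (x i) * (g * X i f) := by
        rw [← Derivation.coeFnAddMonoidHom_apply, map_sum, Finset.sum_apply]
        rfl
      rw [map_add, Gauge.symbol_ofEnd, zero_add, hsymb, hsum, map_smul, Derivation.smul_apply,
        smul_eq_mul, mul_right_comm, hcoord, Finset.sum_mul]
      exact Finset.sum_congr rfl fun i _ => by ring
  have hμ : (h * g) • μ = h • (∑ a, c a (μ.1 (Gauge.ofEnd LinearMap.id)) • jetd (e a)
        - dtensor g (μ.1 (Gauge.ofEnd LinearMap.id)))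
      + ∑ i, dtensor (x i) (μ.1 (frameConnection hframe (X i))) := by
    refine jet_ext fun d => ?_
    have hsum : ∀ v : α → Jet A S, (∑ a, v a).1 d = ∑ a, (v a).1 d := fun v =>
      map_sum (LinearMap.applyₗ d ∘ₗ (Jet A S).subtype) v _
    have hsum' : ∀ v : ι → Jet A S, (∑ i, v i).1 d = ∑ i, (v i).1 d := fun v =>
      map_sum (LinearMap.applyₗ d ∘ₗ (Jet A S).subtype) v _
    rw [jet_smul_apply, ← map_smul, hd, map_add, map_sum, μ.2]
    simp only [jet_add_apply, jet_smul_apply, jet_sub_apply, hsum, hsum', dtensor_apply, map_smul,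
      LinearMap.smul_apply, LinearMap.sub_apply, LinearMap.sum_apply, LinearMap.smulRight_apply,
      LinearMap.id_apply, jetd_apply]
  have hspan : ∀ u : S, (jetd u : Jet A S) ∈ Submodule.span A (Set.range (jetd : S → Jet A S)) :=
    fun u => Submodule.subset_span ⟨u, rfl⟩
  have hspan' : ∀ f (u : S), dtensor f u ∈ Submodule.span A (Set.range (jetd : S → Jet A S)) :=
    fun f u => Submodule.sub_mem _ (hspan _) (Submodule.smul_mem _ _ (hspan _))
  rw [hμ]
  exact Submodule.add_mem _ (Submodule.smul_mem _ _ (Submodule.sub_mem _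
    (Submodule.sum_mem _ fun a _ => Submodule.smul_mem _ _ (hspan _)) (hspan' _ _)))
    (Submodule.sum_mem _ fun i _ => hspan' _ _)

end Algebra

/-! ### Hadamard's lemma in Euclidean space. -/

/-- The average of a smooth function over the segments from a fixed point is smooth. -/
theorem contDiff_segment_average {V : Type*} [NormedAddCommGroup V] [NormedSpace ℝ V]
    {f : V → ℝ} (hf : ContDiff ℝ ∞ f) (p : V) :
    ContDiff ℝ ∞ fun q => ∫ t in (0 : ℝ)..1, f (p + t • (q - p)) := by
  -- The integral is the value at `0` of a convolution in `t` with the indicator of `(0, 1]`, so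
  -- smoothness in the parameter `q` applies. Convolving at `0` flips `t` to `-t`; the cutoff gives
  -- compact support and equals `1` on `[-1, 1]`.
  let χ : ContDiffBump (0 : ℝ) := ⟨1, 2, one_pos, one_lt_two⟩
  have h := contDiffOn_convolution_right_with_param_comp (𝕜 := ℝ) (n := ⊤) (μ := volume)
    (ContinuousLinearMap.mul ℝ ℝ) (s := univ) (v := fun _ : V => (0 : ℝ)) contDiffOn_const
    (f := indicator (Ioc (0 : ℝ) 1) 1) (g := fun q t => χ t * f (p + (-t) • (q - p)))
    (k := tsupport χ) isOpen_univ χ.hasCompactSupport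
    (fun q t _ ht => by rw [image_eq_zero_of_notMem_tsupport ht, zero_mul])
    (by
      refine Integrable.locallyIntegrable ?_
      rw [integrable_indicator_iff measurableSet_Ioc]
      exact integrableOn_const (by simp))
    (by
      refine ContDiff.contDiffOn ?_
      refine (χ.contDiff.comp contDiff_snd).mul (hf.comp ?_)
      fun_prop)
  rw [contDiffOn_univ] at h
  convert h using 1
  funext q
  rw [convolution_def, intervalIntegral.integral_of_le zero_le_one,
    ← integral_indicator measurableSet_Ioc]
  refine integral_congr_ae (Filter.Eventually.of_forall fun t => ?_)
  by_cases ht : t ∈ Ioc (0 : ℝ) 1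
  · have hχ : χ (-t) = 1 := χ.one_of_mem_closedBall (by
      simp only [mem_Ioc] at ht
      simp [abs_of_pos ht.1, ht.2, χ])
    simp [ht, hχ]
  · simp [ht]

/-- Hadamard's lemma. -/
theorem exists_hadamard {n : ℕ} {f : EuclideanSpace ℝ (Fin n) → ℝ} (hf : ContDiff ℝ ∞ f)
    (p : EuclideanSpace ℝ (Fin n)) :
    ∃ G : Fin n → EuclideanSpace ℝ (Fin n) → ℝ, (∀ i, ContDiff ℝ ∞ (G i)) ∧
      (∀ i, G i p = fderiv ℝ f p (EuclideanSpace.single i 1)) ∧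
      ∀ q, f q = f p + ∑ i, (q i - p i) * G i q := by
  have hdf : ∀ i : Fin n, ContDiff ℝ ∞ fun q => fderiv ℝ f q (EuclideanSpace.single i 1) :=
    fun i => (hf.fderiv_right (by simp)).clm_apply contDiff_const
  refine ⟨fun i q => ∫ t in (0 : ℝ)..1, fderiv ℝ f (p + t • (q - p)) (EuclideanSpace.single i 1),
    fun i => contDiff_segment_average (hdf i) p, fun i => by simp, fun q => ?_⟩
  have hderiv : ∀ t : ℝ, HasDerivAt (fun t : ℝ => f (p + t • (q - p)))
      (fderiv ℝ f (p + t • (q - p)) (q - p)) t := fun t => by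
    have h1 : HasDerivAt (fun t : ℝ => p + t • (q - p)) (q - p) t := by
      simpa using ((hasDerivAt_id t).smul_const (q - p)).const_add p
    exact ((hf.differentiable (by simp)) _).hasFDerivAt.comp_hasDerivAt t h1
  have hcont : ∀ v, Continuous fun t : ℝ => fderiv ℝ f (p + t • (q - p)) v := fun v =>
    ((hf.continuous_fderiv (by simp)).comp (by fun_prop)).clm_apply continuous_const
  have h := intervalIntegral.integral_eq_sub_of_hasDerivAt (fun t _ => hderiv t)
    ((hcont (q - p)).intervalIntegrable 0 1)
  simp only [one_smul, zero_smul, add_zero, add_sub_cancel] at h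
  rw [← sub_eq_iff_eq_add', ← h]
  have hv : q - p = ∑ i, (q i - p i) • EuclideanSpace.single i (1 : ℝ) := by
    ext j
    simp [Finset.sum_apply, Pi.single_apply]
  have hsum : ∀ t : ℝ, fderiv ℝ f (p + t • (q - p)) (q - p) =
      ∑ i, (q i - p i) * fderiv ℝ f (p + t • (q - p)) (EuclideanSpace.single i 1) := fun t => by
    -- Only the direction is expanded in the basis; the `q - p` in the base point must stay.
    conv_lhs => rw [show fderiv ℝ f (p + t • (q - p)) (q - p) =
      fderiv ℝ f (p + t • (q - p)) (∑ i, (q i - p i) • EuclideanSpace.single i (1 : ℝ)) from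
        congrArg _ hv, map_sum]
    simp
  simp only [hsum]
  rw [intervalIntegral.integral_finsetSum
    fun i _ => ((hcont _).const_mul _ |>.intervalIntegrable 0 1)]
  simp

/-! ### Bump functions, local coordinates and derivations on the manifold. -/

section Geometry

variable {n : ℕ} {M : Type*} [TopologicalSpace M] [ChartedSpace (EuclideanSpace ℝ (Fin n)) M]
  [IsManifold (𝓡 n) ∞ M] [T2Space M]

/-- A smooth bump function as an element of `C^∞(M)`. -/
def bumpFun {x₀ : M} (ψ : SmoothBumpFunction (𝓡 n) x₀) : C^∞⟮𝓡 n, M; ℝ⟯ := ⟨ψ, ψ.contMDiff⟩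

/-- A function smooth on a chart, extended to the manifold by a bump function. -/
def bumpMul {x₀ : M} (ψ : SmoothBumpFunction (𝓡 n) x₀) (g : M → ℝ)
    (hg : ContMDiffOn (𝓡 n) 𝓘(ℝ, ℝ) ∞ g (chartAt (EuclideanSpace ℝ (Fin n)) x₀).source) :
    C^∞⟮𝓡 n, M; ℝ⟯ :=
  ⟨fun x => ψ x * g x, ψ.contMDiff_smul hg⟩

/-- The `i`-th partial derivative of `f` in the chart at `x₀`. -/
def chartPartial (x₀ : M) (i : Fin n) (f : M → ℝ) (x : M) : ℝ :=
  fderiv ℝ (f ∘ (extChartAt (𝓡 n) x₀).symm) (extChartAt (𝓡 n) x₀ x) (EuclideanSpace.single i 1)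

omit [T2Space M] in
theorem contDiffOn_chart (x₀ : M) (f : C^∞⟮𝓡 n, M; ℝ⟯) :
    ContDiffOn ℝ ∞ (f ∘ (extChartAt (𝓡 n) x₀).symm) (extChartAt (𝓡 n) x₀).target :=
  (f.contMDiff.comp_contMDiffOn (contMDiffOn_extChartAt_symm x₀)).contDiffOn

omit [T2Space M] in
theorem differentiableAt_chart (x₀ : M) (f : C^∞⟮𝓡 n, M; ℝ⟯) {x : M}
    (hx : x ∈ (extChartAt (𝓡 n) x₀).source) :
    DifferentiableAt ℝ (f ∘ (extChartAt (𝓡 n) x₀).symm) (extChartAt (𝓡 n) x₀ x) :=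
  ((contDiffOn_chart x₀ f).contDiffAt ((isOpen_extChartAt_target x₀).mem_nhds
    ((extChartAt (𝓡 n) x₀).map_source hx))).differentiableAt (by simp)

omit [T2Space M] in
theorem contMDiffOn_comp_chart (x₀ : M) {G : EuclideanSpace ℝ (Fin n) → ℝ}
    (hG : ContDiffOn ℝ ∞ G (extChartAt (𝓡 n) x₀).target) :
    ContMDiffOn (𝓡 n) 𝓘(ℝ, ℝ) ∞ (fun x => G (extChartAt (𝓡 n) x₀ x))
      (chartAt (EuclideanSpace ℝ (Fin n)) x₀).source := by
  refine hG.contMDiffOn.comp contMDiffOn_extChartAt fun x hx => ?_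
  rw [← extChartAt_source (𝓡 n)] at hx
  exact (extChartAt (𝓡 n) x₀).map_source hx

omit [T2Space M] in
theorem contMDiffOn_chartPartial (x₀ : M) (i : Fin n) (f : C^∞⟮𝓡 n, M; ℝ⟯) :
    ContMDiffOn (𝓡 n) 𝓘(ℝ, ℝ) ∞ (chartPartial x₀ i f)
      (chartAt (EuclideanSpace ℝ (Fin n)) x₀).source :=
  contMDiffOn_comp_chart x₀ (((contDiffOn_chart x₀ f).fderiv_of_isOpen
    (isOpen_extChartAt_target x₀) (by simp)).clm_apply contDiffOn_const)

/-- The coordinate vector fields of the chart at `x₀`, multiplied by a bump function. -/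
def bumpPartial {x₀ : M} (ψ : SmoothBumpFunction (𝓡 n) x₀) (i : Fin n) :
    Derivation ℝ C^∞⟮𝓡 n, M; ℝ⟯ C^∞⟮𝓡 n, M; ℝ⟯ :=
  Derivation.mk'
    { toFun := fun f => bumpMul ψ (chartPartial x₀ i f) (contMDiffOn_chartPartial x₀ i f)
      map_add' := fun f g => by
        ext x
        change ψ x * _ = ψ x * _ + ψ x * _
        by_cases hx : x ∈ (extChartAt (𝓡 n) x₀).source
        · rw [← mul_add]
          congr 1
          exact congrArg (fun L => L (EuclideanSpace.single i 1))
            (fderiv_add (differentiableAt_chart x₀ f hx) (differentiableAt_chart x₀ g hx))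
        · rw [extChartAt_source] at hx
          simp [Function.notMem_support.1 fun h => hx (ψ.support_subset_source h)]
      map_smul' := fun r f => by
        ext x
        change ψ x * _ = r * (ψ x * _)
        by_cases hx : x ∈ (extChartAt (𝓡 n) x₀).source
        · rw [mul_left_comm]
          congr 1
          exact congrArg (fun L => L (EuclideanSpace.single i 1))
            (fderiv_const_smul (differentiableAt_chart x₀ f hx) r)
        · rw [extChartAt_source] at hx
          simp [Function.notMem_support.1 fun h => hx (ψ.support_subset_source h)] }
    fun f g => by
      ext x
      change ψ x * _ = f x * (ψ x * _) + g x * (ψ x * _)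
      by_cases hx : x ∈ (extChartAt (𝓡 n) x₀).source
      · rw [mul_left_comm, mul_left_comm (g x), ← mul_add]
        congr 1
        have h := congrArg (fun L => L (EuclideanSpace.single i 1))
            (fderiv_mul (differentiableAt_chart x₀ f hx) (differentiableAt_chart x₀ g hx))
        refine h.trans ?_
        change f ((extChartAt (𝓡 n) x₀).symm (extChartAt (𝓡 n) x₀ x)) * _ +
          g ((extChartAt (𝓡 n) x₀).symm (extChartAt (𝓡 n) x₀ x)) * _ = _
        rw [(extChartAt (𝓡 n) x₀).left_inv hx]
        rfl
      · rw [extChartAt_source] at hx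
        simp [Function.notMem_support.1 fun h => hx (ψ.support_subset_source h)]

/-- The coordinate functions of the chart at `x₀`, multiplied by a bump function. -/
def bumpCoord {x₀ : M} (ψ : SmoothBumpFunction (𝓡 n) x₀) (i : Fin n) : C^∞⟮𝓡 n, M; ℝ⟯ :=
  bumpMul ψ (fun x => extChartAt (𝓡 n) x₀ x i)
    (contMDiffOn_comp_chart x₀ (G := fun q => q i) (by fun_prop))

omit [T2Space M] in
/-- A smooth function cut off by a bump function and read in a chart is smooth. -/
theorem contDiff_bump_mul_chart {x₀ : M} (ψ : SmoothBumpFunction (𝓡 n) x₀)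
    (f : C^∞⟮𝓡 n, M; ℝ⟯) :
    ContDiff ℝ ∞ fun q => ψ.toContDiffBump q * f ((extChartAt (𝓡 n) x₀).symm q) := by
  refine contDiff_iff_contDiffAt.2 fun q => ?_
  by_cases hq : q ∈ (extChartAt (𝓡 n) x₀).target
  · exact ψ.toContDiffBump.contDiffAt.mul
      ((contDiffOn_chart x₀ f).contDiffAt ((isOpen_extChartAt_target x₀).mem_nhds hq))
  · have hq' : q ∉ tsupport ψ.toContDiffBump := fun h => by
      rw [ψ.toContDiffBump.tsupport_eq] at h
      exact hq (ψ.closedBall_subset ⟨h, by simp⟩)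
    refine (contDiffAt_const (c := (0 : ℝ))).congr_of_eventuallyEq ?_
    filter_upwards [notMem_tsupport_iff_eventuallyEq.1 hq'] with p hp
    rw [hp, Pi.zero_apply, zero_mul]

/-- A vector field on `M` is determined by the derivatives of local coordinates. -/
theorem mul_derivation_eq_sum {x₀ : M} (ψ h : SmoothBumpFunction (𝓡 n) x₀)
    (hψ : ∀ y, h y ≠ 0 → dist (extChartAt (𝓡 n) x₀ y) (extChartAt (𝓡 n) x₀ x₀) < ψ.rIn)
    (Y : Derivation ℝ C^∞⟮𝓡 n, M; ℝ⟯ C^∞⟮𝓡 n, M; ℝ⟯) (f : C^∞⟮𝓡 n, M; ℝ⟯) :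
    bumpFun h * Y f = ∑ i, bumpPartial h i f * Y (bumpCoord ψ i) := by
  have hone : ∀ y, h y ≠ 0 → ψ y = 1 := fun y hy =>
    ψ.one_of_dist_le (h.support_subset_source hy) (hψ y hy).le
  have coe_sum : ∀ (v : Fin n → C^∞⟮𝓡 n, M; ℝ⟯) y, (∑ i, v i) y = ∑ i, v i y := fun v y => by
    rw [← ContMDiffMap.coeFnAddMonoidHom_apply, map_sum, Finset.sum_apply]
    rfl
  ext y
  rw [coe_sum]
  change h y * Y f y = ∑ i, h y * chartPartial x₀ i f y * Y (bumpCoord ψ i) y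
  by_cases hy : h y = 0
  · simp [hy]
  simp only [mul_assoc, ← Finset.mul_sum]
  congr 1
  have hys : y ∈ (extChartAt (𝓡 n) x₀).source := by
    rw [extChartAt_source]
    exact h.support_subset_source hy
  -- Locality of a derivation: `ψ = 1` wherever `h ≠ 0`, so applying `Y` to `h (1 - ψ) = 0` and
  -- evaluating at `y` isolates the derivative of `ψ`.
  have hYψ : Y (bumpFun ψ) y = 0 := by
    have h0 : bumpFun h * (1 - bumpFun ψ) = 0 := by
      ext z
      change h z * (1 - ψ z) = 0
      by_cases hz : h z = 0
      · simp [hz]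
      · simp [hone z hz]
    have h1 := congrArg (fun f : C^∞⟮𝓡 n, M; ℝ⟯ => f y) (congrArg Y h0)
    rw [Y.leibniz, map_sub, Y.map_one_eq_zero, zero_sub, map_zero] at h1
    change h y * -(Y (bumpFun ψ) y) + (1 - ψ y) * Y (bumpFun h) y = 0 at h1
    simpa [hone y hy, hy] using h1
  obtain ⟨G, hG, hGp, hf⟩ := exists_hadamard (contDiff_bump_mul_chart ψ f) (extChartAt (𝓡 n) x₀ y)
  let H : Fin n → C^∞⟮𝓡 n, M; ℝ⟯ := fun i =>
    bumpMul ψ _ (contMDiffOn_comp_chart x₀ (hG i).contDiffOn)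
  have hψy : ψ.toContDiffBump (extChartAt (𝓡 n) x₀ y) = 1 :=
    ψ.toContDiffBump.one_of_mem_closedBall (hψ y hy).le
  -- Hadamard's expansion of `ψ f` about `y`, times `ψ²`: one more factor makes the coordinates
  -- global, the other makes the coefficients global. Applying `Y` at `y` kills the derivatives of
  -- `ψ` and of the coefficients.
  have hkey : bumpFun ψ * (bumpFun ψ * (bumpFun ψ * f)) = f y • (bumpFun ψ * bumpFun ψ) +
      ∑ i, (bumpCoord ψ i - (extChartAt (𝓡 n) x₀ y i) • bumpFun ψ) * H i := by
    ext z
    change ψ z * (ψ z * (ψ z * f z)) = f y * (ψ z * ψ z) + (∑ i, _ : C^∞⟮𝓡 n, M; ℝ⟯) z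
    rw [coe_sum]
    change _ = _ + ∑ i, (ψ z * extChartAt (𝓡 n) x₀ z i - extChartAt (𝓡 n) x₀ y i * ψ z) *
      (ψ z * G i (extChartAt (𝓡 n) x₀ z))
    by_cases hz : ψ z = 0
    · simp [hz]
    have hzs := ψ.support_subset_source hz
    have hfz := hf (extChartAt (𝓡 n) x₀ z)
    rw [(extChartAt (𝓡 n) x₀).left_inv hys, hψy, one_mul,
      (extChartAt (𝓡 n) x₀).left_inv (by rwa [extChartAt_source])] at hfz
    have hψz : ψ.toContDiffBump (extChartAt (𝓡 n) x₀ z) = ψ z := (ψ.eqOn_source hzs).symm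
    rw [hψz] at hfz
    rw [hfz, mul_add, mul_add, Finset.mul_sum, Finset.mul_sum]
    congr 1
    · ring
    · exact Finset.sum_congr rfl fun i _ => by ring
  have vmul : ∀ a b : C^∞⟮𝓡 n, M; ℝ⟯, Y (a * b) y = a y * Y b y + b y * Y a y := fun a b => by
    rw [Y.leibniz]
    rfl
  have vψ : bumpFun ψ y = 1 := hone y hy
  have vsmul : ∀ (r : ℝ) (a : C^∞⟮𝓡 n, M; ℝ⟯), Y (r • a) y = r * Y a y := fun r a => by
    rw [Y.map_smul]
    rfl
  have vsub : ∀ a b : C^∞⟮𝓡 n, M; ℝ⟯, Y (a - b) y = Y a y - Y b y := fun a b => by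
    rw [map_sub]
    rfl
  have vadd : ∀ a b : C^∞⟮𝓡 n, M; ℝ⟯, Y (a + b) y = Y a y + Y b y := fun a b => by
    rw [map_add]
    rfl
  have hY := congrArg (fun f : C^∞⟮𝓡 n, M; ℝ⟯ => f y) (congrArg Y hkey)
  simp only [vadd, map_sum, coe_sum, vmul, vsmul, vsub, hYψ, vψ] at hY
  have hcoord : ∀ i, (bumpCoord ψ i - (extChartAt (𝓡 n) x₀ y i) • bumpFun ψ) y = 0 := fun i => by
    change ψ y * extChartAt (𝓡 n) x₀ y i - extChartAt (𝓡 n) x₀ y i * ψ y = 0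
    ring
  -- The Hadamard coefficient is a partial derivative of the cut-off function, and the cutoff is `1`
  -- near the image of `y`.
  have hH : ∀ i, H i y = chartPartial x₀ i f y := fun i => by
    change ψ y * G i (extChartAt (𝓡 n) x₀ y) = _
    rw [hone y hy, one_mul, hGp]
    refine congrArg (fun L : _ →L[ℝ] ℝ => L (EuclideanSpace.single i 1))
      (Filter.EventuallyEq.fderiv_eq ?_)
    filter_upwards [ψ.toContDiffBump.eventuallyEq_one_of_mem_ball (hψ y hy)] with q hq
    rw [hq, Pi.one_apply, one_mul]
    rfl
  simp only [hcoord, hH] at hY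
  simpa using hY

/-- Local coordinates around every point. -/
theorem exists_coordinates (x₀ : M) :
    ∃ (h : C^∞⟮𝓡 n, M; ℝ⟯) (X : Fin n → Derivation ℝ C^∞⟮𝓡 n, M; ℝ⟯ C^∞⟮𝓡 n, M; ℝ⟯)
      (x : Fin n → C^∞⟮𝓡 n, M; ℝ⟯), h x₀ ≠ 0 ∧ ∀ (Y : Derivation ℝ _ _) (f : C^∞⟮𝓡 n, M; ℝ⟯),
        h * Y f = ∑ i, X i f * Y (x i) := by
  obtain ⟨ψ⟩ : Nonempty (SmoothBumpFunction (𝓡 n) x₀) := inferInstance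
  have hs : extChartAt (𝓡 n) x₀ ⁻¹' Metric.ball (extChartAt (𝓡 n) x₀ x₀) ψ.rIn ∈ nhds x₀ :=
    (continuousAt_extChartAt x₀).preimage_mem_nhds (Metric.ball_mem_nhds _ ψ.rIn_pos)
  obtain ⟨h, hh⟩ := (SmoothBumpFunction.nhds_basis_support (I := 𝓡 n) hs).ex_mem
  refine ⟨bumpFun h, bumpPartial h, bumpCoord ψ, ?_, mul_derivation_eq_sum ψ h fun y hy => ?_⟩
  · change h x₀ ≠ 0
    rw [h.eq_one]
    exact one_ne_zero
  · exact hh (subset_tsupport h hy)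

/-! ### Local frames of the bundle and local spanning of jets. -/

variable {F : Type*} [NormedAddCommGroup F] [NormedSpace ℝ F] [FiniteDimensional ℝ F]
  {E : M → Type*} [TopologicalSpace (Bundle.TotalSpace F E)]
  [∀ x, AddCommGroup (E x)] [∀ x, Module ℝ (E x)] [∀ x, TopologicalSpace (E x)]
  [FiberBundle F E] [VectorBundle ℝ F E] [ContMDiffVectorBundle ∞ F E (𝓡 n)]

/-- Local frames around every point. -/
theorem exists_frame (x₀ : M) :
    ∃ (g : C^∞⟮𝓡 n, M; ℝ⟯)
      (c : Fin (Module.finrank ℝ F) → Cₛ^∞⟮𝓡 n; F, E⟯ →ₗ[C^∞⟮𝓡 n, M; ℝ⟯] C^∞⟮𝓡 n, M; ℝ⟯)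
      (e : Fin (Module.finrank ℝ F) → Cₛ^∞⟮𝓡 n; F, E⟯),
      g x₀ ≠ 0 ∧ ∀ u, ∑ a, c a u • e a = g • u := by
  have : ContMDiffVectorBundle 1 F E (𝓡 n) := ContMDiffVectorBundle.of_le (n := ∞) (by simp)
  let t := trivializationAt F E x₀
  let b := Module.finBasis ℝ F
  obtain ⟨ψ, hψ⟩ := (SmoothBumpFunction.nhds_basis_support (I := 𝓡 n)
    (t.open_baseSet.mem_nhds (FiberBundle.mem_baseSet_trivializationAt' x₀))).ex_mem
  have hzero : ∀ x, x ∉ t.baseSet → ψ x = 0 := fun x hx =>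
    Function.notMem_support.1 fun h => hx (hψ (subset_tsupport ψ h))
  let c : Fin (Module.finrank ℝ F) → Cₛ^∞⟮𝓡 n; F, E⟯ →ₗ[C^∞⟮𝓡 n, M; ℝ⟯] C^∞⟮𝓡 n, M; ℝ⟯ :=
    fun a =>
    { toFun := fun u => ⟨fun x => ψ x * t.localFrameCoeff (𝓡 n) b a x (u x), by
        refine contMDiff_of_tsupport fun x hx => ?_
        have hx' : x ∈ t.baseSet := hψ (tsupport_smul_subset_left (ψ : M → ℝ) _ hx)
        exact ψ.contMDiffAt.mul (contMDiffAt_localFrameCoeff b hx'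
          u.contMDiff.contMDiffAt a)⟩
      map_add' := fun u v => by
        ext x
        change ψ x * t.localFrameCoeff (𝓡 n) b a x (u x + v x) = ψ x * _ + ψ x * _
        rw [map_add, mul_add]
      map_smul' := fun f u => by
        ext x
        change ψ x * t.localFrameCoeff (𝓡 n) b a x (f x • u x) = f x * (ψ x * _)
        rw [map_smul, smul_eq_mul, mul_left_comm] }
  let e : Fin (Module.finrank ℝ F) → Cₛ^∞⟮𝓡 n; F, E⟯ := fun a =>
    ⟨fun x => ψ x • t.localFrame b a x,
      ContMDiffOn.smul_section_of_tsupport ψ.contMDiff.contMDiffOn t.open_baseSet hψ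
        (t.contMDiffOn_localFrame_baseSet _ b a)⟩
  -- The square appears because coefficients and frame sections each carry one cutoff in order to be
  -- globally smooth.
  refine ⟨bumpFun ψ * bumpFun ψ, c, e, ?_, fun u => ?_⟩
  · change ψ x₀ * ψ x₀ ≠ 0
    rw [ψ.eq_one]
    norm_num
  · ext x
    have hsum : (∑ a, c a u • e a) x = ∑ a, (c a u • e a) x := by
      rw [← ContMDiffSection.coeAddHom_apply, map_sum, Finset.sum_apply]
      rfl
    rw [hsum]
    change ∑ a, (ψ x * t.localFrameCoeff (𝓡 n) b a x (u x)) • ψ x • t.localFrame b a x =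
      (ψ x * ψ x) • u x
    by_cases hx : x ∈ t.baseSet
    · conv_rhs => rw [t.eq_sum_localFrameCoeff_smul (I := 𝓡 n) (b := b) (s := u) hx,
        Finset.smul_sum]
      refine Finset.sum_congr rfl fun a _ => ?_
      rw [smul_smul, smul_smul]
      congr 1
      ring
    · simp [hzero x hx]

/-- Jets of sections of a smooth vector bundle are locally spanned by prolongations. -/
theorem locallySpanned : LocallySpanned C^∞⟮𝓡 n, M; ℝ⟯ Cₛ^∞⟮𝓡 n; F, E⟯ := by
  have hk : ∀ x₀ : M, ∃ k ∈ spanningFunctions C^∞⟮𝓡 n, M; ℝ⟯ Cₛ^∞⟮𝓡 n; F, E⟯, k x₀ ≠ 0 :=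
    fun x₀ => by
    obtain ⟨h, X, x, hh, hcoord⟩ := exists_coordinates (n := n) x₀
    obtain ⟨g, c, e, hg, hframe⟩ := exists_frame (n := n) (F := F) (E := E) x₀
    exact ⟨h * g, mul_mem_spanningFunctions hframe hcoord, mul_ne_zero hh hg⟩
  refine ⟨fun a ha => ?_, fun s hs => ?_⟩
  · ext x
    obtain ⟨k, hk, hkx⟩ := hk x
    have : k x * a x = 0 := congrArg (fun f : C^∞⟮𝓡 n, M; ℝ⟯ => f x) (ha k hk)
    exact (mul_eq_zero.1 this).resolve_left hkx
  · ext x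
    obtain ⟨k, hk, hkx⟩ := hk x
    have : k x • s x = 0 := congrArg (fun f : Cₛ^∞⟮𝓡 n; F, E⟯ => f x) (hs k hk)
    exact (smul_eq_zero.1 this).resolve_left hkx

omit [IsManifold (𝓡 n) ∞ M] [T2Space M] in
theorem isReduced_smoothFunctions : IsReduced C^∞⟮𝓡 n, M; ℝ⟯ := by
  refine ⟨fun f ⟨k, hf⟩ => ?_⟩
  ext x
  have h : (f ^ k) x = 0 := by rw [hf]; rfl
  have h' : (f ^ k) x = f x ^ k := by rw [ContMDiffMap.coe_pow, Pi.pow_apply]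
  rw [h'] at h
  exact eq_zero_of_pow_eq_zero h

end Geometry

end OmniLie

end

theorem mainTheorem4
    {n : ℕ} {M : Type*} [TopologicalSpace M] [ChartedSpace (EuclideanSpace ℝ (Fin n)) M]
    [IsManifold (𝓡 n) ∞ M] [T2Space M] [SecondCountableTopology M]
    {F : Type*} [NormedAddCommGroup F] [NormedSpace ℝ F] [FiniteDimensional ℝ F]
    {E : M → Type*} [TopologicalSpace (Bundle.TotalSpace F E)]
    [∀ x, AddCommGroup (E x)] [∀ x, Module ℝ (E x)] [∀ x, TopologicalSpace (E x)]
    [FiberBundle F E] [VectorBundle ℝ F E] [ContMDiffVectorBundle ∞ F E (𝓡 n)]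
    (𝓔 : OmniLie.LieAlgebroid C^∞⟮𝓡 n, M; ℝ⟯ Cₛ^∞⟮𝓡 n; F, E⟯)
    (pi : OmniLie.Jet C^∞⟮𝓡 n, M; ℝ⟯ Cₛ^∞⟮𝓡 n; F, E⟯ →ₗ[C^∞⟮𝓡 n, M; ℝ⟯]
      OmniLie.Gauge C^∞⟮𝓡 n, M; ℝ⟯ Cₛ^∞⟮𝓡 n; F, E⟯)
    (hpi : OmniLie.IsInducedBy 𝓔 pi)
    (N : OmniLie.Gauge C^∞⟮𝓡 n, M; ℝ⟯ Cₛ^∞⟮𝓡 n; F, E⟯ →ₗ[C^∞⟮𝓡 n, M; ℝ⟯]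
      OmniLie.Gauge C^∞⟮𝓡 n, M; ℝ⟯ Cₛ^∞⟮𝓡 n; F, E⟯)
    (hN : OmniLie.IsNijenhuis
      (OmniLie.gaugeLieAlgebroid C^∞⟮𝓡 n, M; ℝ⟯ Cₛ^∞⟮𝓡 n; F, E⟯) N) :
    (OmniLie.IsAlgebroidNijenhuis 𝓔 pi N ∧ ∀ d, N (N d) = -d) ↔
      ∃ hN' : OmniLie.PreservesJet N,
        OmniLie.IsGeneralizedComplex (OmniLie.omniMatrix N hN' pi) := by
  have := OmniLie.isReduced_smoothFunctions (n := n) (M := M)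
  constructor
  · rintro ⟨h, hsq⟩
    exact ⟨h.preservesJet,
      OmniLie.isGeneralizedComplex_of_isAlgebroidNijenhuis OmniLie.locallySpanned h hsq⟩
  · rintro ⟨_, hJ⟩
    exact OmniLie.isAlgebroidNijenhuis_of_isGeneralizedComplex hpi hN hJ
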